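/- Let $\Bbbk$ be a commutative ring, $A$ an associative unital $\Bbbk$-algebra and $\Omega^\bullet_d=\bigoplus_{n\ge 0}\Omega^n_d$ an exterior algebra over $A$, i.e. a differential graded $\Bbbk$-algebra with $\Omega^0_d=A$ that is generated as an algebra by $A$ and $dA$. For a left $A$-module $E$ put $J^1_dE=J^1_dA\otimes_A E$, where $J^1_dA=(A\otimes_{\Bbbk} A)/\{\sum_i a_i\otimes b_i : \sum_i a_ib_i=0,\ \sum_i a_i\,db_i=0\}$, and define: * the symmetric forms $S^0_dE=E$, $S^1_dE=\Omega^1_d\otimes_AE$ and, for $n\ge 2$, $S^n_dE=\ker\big(\Omega^1_d\otimes_A S^{n-1}_dE\to\Omega^1_d\otimes_A\Omega^1_d\otimes_A S^{n-2}_dE\xrightarrow{\wedge}\Omega^2_d\otimes_AS^{n-2}_dE\big)$; the Spencer $\delta$-operators $\delta^{n,m}:\Omega^m_d\otimes_AS^n_dE\to\Omega^{m+1}_d\otimes_AS^{n-1}_dE$, $\omega\otimes\sum_j\alpha_j\otimes s_j\mapsto(-1)^m\sum_j(\omega\wedge\alpha_j)\otimes s_j$ for $n\ge1$; and the Spencer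 $\delta$-cohomology $H^{n,m}_{\delta_d}(E)$, the cohomology at $\Omega^m_d\otimes_AS^n_dE$ of the complex $0\to S^{n+m}_dE\to\Omega^1_d\otimes_AS^{n+m-1}_dE\to\cdots\to\Omega^{n+m}_d\otimes_AE\to0$; * the holonomic jets $J^0_dE=E$, $J^1_dE$ and, for $n\ge2$, $J^n_dE\subseteq J^1_dJ^{n-1}_dE$, the submodule of the elements whose image in $J^1_dJ^1_dJ^{n-2}_dE$ is killed by both maps $[a\otimes b]\otimes[c\otimes f]\otimes e\mapsto a\,d(bc)f\otimes e\in\Omega^1_d\otimes_A J^{n-2}_dE$ and $[a\otimes b]\otimes[c\otimes f]\otimes e\mapsto da\wedge d(bc)f\otimes e\in\Omega^2_d\otimes_A J^{n-2}_dE$; the prolongations $j^n_d:E\to J^n_dE$ given by $j^0_d=\mathrm{id}$ and $j^n_d(e)=[1\otimes1]\otimes j^{n-1}_d(e)$; and the Spencer operators $\mathcal S^{n,m}_d:\Omega^m_d\otimes_AJ^n_dE\to\Omega^{m+1}_d\otimes_AJ^{n-1}_dE$, $\omega\otimes\sum_j[y_j\otimes z_j]\otimes\xi_j\mapsto\sum_jd(\omega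 y_j)z_j\otimes\xi_j$ for $n\ge1$. The Spencer complex of order $N\ge0$ at $E$ is $$0\to E\xrightarrow{j^N_d}J^N_dE\xrightarrow{\mathcal S^{N,0}_d}\Omega^1_d\otimes_AJ^{N-1}_dE\xrightarrow{\mathcal S^{N-1,1}_d}\cdots\xrightarrow{\mathcal S^{1,N-1}_d}\Omega^N_d\otimes_AE\to0,$$ and $H^{n,m}_{\mathcal S_d}(E)$ denotes its cohomology at $\Omega^m_d\otimes_AJ^n_dE$ (with $N=n+m$). **Corollary 3.31.** Suppose that every $\Omega^m_d$, $m\ge 0$, is flat as a right $A$-module and that $H^{n,m}_{\delta_d}(E)=0$ for all left $A$-modules $E$ and all $n,m\ge0$ with $(n,m)\ne(0,0)$. Then the Spencer complex is exact: for every left $A$-module $E$, $H^{n,m}_{\mathcal S_d}(E)=0$ for all $n,m\ge0$, and every $j^n_d:E\to J^n_dE$ is injective. -/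

import Mathlib

open scoped TensorProduct
open MulOpposite

noncomputable section

universe u v

namespace NCJet

section Balanced

variable (A : Type u) [Ring A]
variable (M : Type u) [AddCommGroup M] [Module Aᵐᵒᵖ M]
variable (E : Type u) [AddCommGroup E] [Module A E]

/-- The relations `m a ⊗ e = m ⊗ a e` that cut the tensor product over `A` out of the tensor
product of abelian groups. -/
def balancedRel : AddSubgroup (M ⊗[ℤ] E) :=
  AddSubgroup.closure {x | ∃ (m : M) (a : A) (e : E),
    x = (op a • m) ⊗ₜ[ℤ] e - m ⊗ₜ[ℤ] (a • e)}

/-- The tensor product `M ⊗_A E` of a right module and a left module over a (not necessarily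
commutative) ring `A`. -/
def BT : Type u := (M ⊗[ℤ] E) ⧸ balancedRel A M E

instance : AddCommGroup (BT A M E) :=
  inferInstanceAs (AddCommGroup ((M ⊗[ℤ] E) ⧸ balancedRel A M E))

variable {M E}

/-- The class of the pure tensor `m ⊗ e` in `M ⊗_A E`. -/
def BT.tmul (m : M) (e : E) : BT A M E :=
  QuotientAddGroup.mk' (balancedRel A M E) (m ⊗ₜ[ℤ] e)

theorem BT.tmul_add (m : M) (e f : E) :
    BT.tmul A m (e + f) = BT.tmul A m e + BT.tmul A m f := by
  simp only [BT.tmul, TensorProduct.tmul_add]; exact map_add _ _ _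

theorem BT.add_tmul (m n : M) (e : E) :
    BT.tmul A (m + n) e = BT.tmul A m e + BT.tmul A n e := by
  simp only [BT.tmul, TensorProduct.add_tmul]; exact map_add _ _ _

theorem BT.tmul_zero (m : M) : BT.tmul A m (0 : E) = 0 := by
  simp only [BT.tmul, TensorProduct.tmul_zero]; exact map_zero _

theorem BT.zero_tmul (e : E) : BT.tmul A (0 : M) e = 0 := by
  simp only [BT.tmul, TensorProduct.zero_tmul]; exact map_zero _

theorem BT.smul_tmul (m : M) (a : A) (e : E) :
    BT.tmul A (op a • m) e = BT.tmul A m (a • e) := by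
  exact (QuotientAddGroup.eq_iff_sub_mem (N := balancedRel A M E)).2 <|
    AddSubgroup.subset_closure ⟨m, a, e, rfl⟩

variable {A} in
@[elab_as_elim]
theorem BT.induction {P : BT A M E → Prop} (x : BT A M E) (h0 : P 0)
    (ht : ∀ m e, P (BT.tmul A m e)) (ha : ∀ x y, P x → P y → P (x + y)) : P x := by
  obtain ⟨t, rfl⟩ := QuotientAddGroup.mk'_surjective (balancedRel A M E) x
  induction t using TensorProduct.induction_on with
  | zero => rw [map_zero]; exact h0
  | tmul m e => exact ht m e
  | add x y hx hy => rw [map_add]; exact ha _ _ hx hy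

variable {G : Type*} [AddCommGroup G]

variable {A} in
/-- The universal property of `M ⊗_A E`: a balanced biadditive map factors through it. -/
def BT.lift (f : M → E → G) (hl : ∀ m n e, f (m + n) e = f m e + f n e)
    (hr : ∀ m e e', f m (e + e') = f m e + f m e')
    (hb : ∀ m (a : A) e, f (op a • m) e = f m (a • e)) : BT A M E →+ G :=
  QuotientAddGroup.lift (balancedRel A M E)
    (TensorProduct.liftAddHom
      (AddMonoidHom.mk' (fun m => AddMonoidHom.mk' (f m) (hr m))
        (fun m n => AddMonoidHom.ext fun e => hl m n e))
      (fun z m e => by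
        rw [map_zsmul, map_zsmul]; rfl))
    (by
      rw [balancedRel, AddSubgroup.closure_le]
      rintro _ ⟨m, a, e, rfl⟩
      simp only [SetLike.mem_coe, AddMonoidHom.mem_ker, map_sub,
        TensorProduct.liftAddHom_tmul, AddMonoidHom.mk'_apply, sub_eq_zero]
      exact hb m a e)

@[simp] theorem BT.lift_tmul (f : M → E → G) (hl hr) (hb : ∀ m (a : A) e, f (op a • m) e = f m (a • e))
    (m : M) (e : E) : BT.lift f hl hr hb (BT.tmul A m e) = f m e := rfl

variable {F : Type u} [AddCommGroup F] [Module A F]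

variable {A} (M) in
/-- The additive map `id_M ⊗_A f` induced by an `A`-linear map `f`. -/
def BT.map (f : E →ₗ[A] F) : BT A M E →+ BT A M F :=
  BT.lift (fun m e => BT.tmul A m (f e)) (fun _ _ _ => BT.add_tmul A _ _ _)
    (fun _ _ _ => by rw [map_add, BT.tmul_add]) (fun m a e => by rw [BT.smul_tmul, map_smul])

@[simp] theorem BT.map_tmul (f : E →ₗ[A] F) (m : M) (e : E) :
    BT.map M f (BT.tmul A m e) = BT.tmul A m (f e) := rfl

section LeftModule

variable [Module A M] [SMulCommClass A Aᵐᵒᵖ M]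

/-- Left multiplication by `a` on `M ⊗_A E`, for a bimodule `M`. -/
def BT.smulHom (a : A) : BT A M E →+ BT A M E :=
  BT.lift (fun m e => BT.tmul A (a • m) e) (fun _ _ _ => by rw [smul_add, BT.add_tmul])
    (fun _ _ _ => BT.tmul_add A _ _ _)
    (fun m b e => by rw [smul_comm a (op b) m, BT.smul_tmul])

instance : SMul A (BT A M E) := ⟨fun a x => BT.smulHom A a x⟩

theorem BT.smul_def (a : A) (m : M) (e : E) :
    a • BT.tmul A m e = BT.tmul A (a • m) e := rfl

/-- For a bimodule `M`, `M ⊗_A E` is a left `A`-module through `a (m ⊗ e) = (a m) ⊗ e`. -/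
instance : Module A (BT A M E) where
  smul_zero a := map_zero (BT.smulHom A a)
  smul_add a := map_add (BT.smulHom A a)
  one_smul x := by
    induction x using BT.induction with
    | h0 => exact map_zero (BT.smulHom A 1)
    | ht m e => rw [BT.smul_def, one_smul]
    | ha x y hx hy => exact (map_add (BT.smulHom A 1) x y).trans (congrArg₂ _ hx hy)
  mul_smul a b x := by
    change BT.smulHom A (a * b) x = BT.smulHom A a (BT.smulHom A b x)
    induction x using BT.induction with
    | h0 => simp only [map_zero]
    | ht m e =>
      change BT.tmul A ((a * b) • m) e = BT.tmul A (a • b • m) e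
      rw [mul_smul]
    | ha x y hx hy => simp only [map_add, hx, hy]
  add_smul a b x := by
    change BT.smulHom A (a + b) x = BT.smulHom A a x + BT.smulHom A b x
    induction x using BT.induction with
    | h0 => simp only [map_zero, add_zero]
    | ht m e =>
      change BT.tmul A ((a + b) • m) e = BT.tmul A (a • m) e + BT.tmul A (b • m) e
      rw [add_smul, BT.add_tmul]
    | ha x y hx hy => simp only [map_add, hx, hy]; abel
  zero_smul x := by
    change BT.smulHom A 0 x = 0
    induction x using BT.induction with
    | h0 => simp only [map_zero]
    | ht m e =>
      change BT.tmul A ((0 : A) • m) e = 0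
      rw [zero_smul, BT.zero_tmul]
    | ha x y hx hy => simp only [map_add, hx, hy, add_zero]

theorem BT.map_smul (f : E →ₗ[A] F) (a : A) (x : BT A M E) :
    BT.map M f (a • x) = a • BT.map M f x := by
  induction x using BT.induction with
  | h0 => simp
  | ht m e => simp [BT.smul_def]
  | ha x y hx hy => simp only [smul_add, map_add, hx, hy]

end LeftModule

section Lift2

variable {N P : Type u} [AddCommGroup N] [Module A N] [Module Aᵐᵒᵖ N] [SMulCommClass A Aᵐᵒᵖ N]
variable [AddCommGroup P] [Module Aᵐᵒᵖ P]

variable {A} (E) in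
/-- The map `M ⊗_A N ⊗_A E → P ⊗_A E`, `m ⊗ n ⊗ e ↦ f m n ⊗ e`, given by a biadditive map
`f` that is balanced over `A` and right `A`-linear in the second variable. -/
def BT.lift₂ (f : M → N → P) (hl : ∀ m m' n, f (m + m') n = f m n + f m' n)
    (hr : ∀ m n n', f m (n + n') = f m n + f m n')
    (hb : ∀ m (a : A) n, f (op a • m) n = f m (a • n))
    (hc : ∀ m (a : A) n, f m (op a • n) = op a • f m n) :
    BT A M (BT A N E) →+ BT A P E :=
  BT.lift
    (fun m => BT.lift (fun n e => BT.tmul A (f m n) e)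
      (fun n n' e => by rw [hr, BT.add_tmul])
      (fun _ _ _ => BT.tmul_add A _ _ _)
      (fun n a e => by rw [hc, BT.smul_tmul]))
    (fun m m' y => by
      induction y using BT.induction with
      | h0 => simp
      | ht n e => simp only [BT.lift_tmul]; rw [hl, BT.add_tmul]
      | ha x y hx hy => simp only [map_add, hx, hy]; abel)
    (fun _ _ _ => map_add _ _ _)
    (fun m a y => by
      induction y using BT.induction with
      | h0 => simp
      | ht n e => simp only [BT.lift_tmul, BT.smul_def]; rw [hb]
      | ha x y hx hy => simp only [map_add, smul_add, hx, hy])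

@[simp] theorem BT.lift₂_tmul (f : M → N → P) (hl hr)
    (hb : ∀ m (a : A) n, f (op a • m) n = f m (a • n)) (hc) (m : M) (n : N) (e : E) :
    BT.lift₂ E f hl hr hb hc (BT.tmul A m (BT.tmul A n e)) = BT.tmul A (f m n) e := rfl

end Lift2


variable (M) in
/-- A right `A`-module `M` is flat if `M ⊗_A -` preserves injective maps of left `A`-modules. -/
def IsFlatRight : Prop :=
  ∀ (E F : Type u) [AddCommGroup E] [Module A E] [AddCommGroup F] [Module A F] (f : E →ₗ[A] F),
    Function.Injective f → Function.Injective (BT.map M f)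

end Balanced

/-- An exterior algebra over the `k`-algebra `A`: a differential graded `k`-algebra
`Ω = ⨁ₙ Ωⁿ` with `Ω⁰ = A` that is generated, as an algebra, by `A` and `dA`. -/
structure ExtAlg (k : Type v) (A : Type u) [CommRing k] [Ring A] [Algebra k A] where
  /-- the total algebra, whose product is the wedge product -/
  Ω : Type u
  [ring : Ring Ω]
  [algebra : Algebra k Ω]
  /-- the homogeneous pieces -/
  deg : ℕ → Submodule k Ω
  gradedMonoid : SetLike.GradedMonoid deg
  isInternal : DirectSum.IsInternal deg
  /-- the identification of `A` with the piece of degree zero -/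
  ofA : A →ₐ[k] Ω
  ofA_injective : Function.Injective ofA
  range_ofA : LinearMap.range ofA.toLinearMap = deg 0
  /-- the exterior derivative -/
  d : Ω →ₗ[k] Ω
  d_mem : ∀ n, ∀ ω ∈ deg n, d ω ∈ deg (n + 1)
  d_d : ∀ ω, d (d ω) = 0
  leibniz : ∀ n, ∀ ω ∈ deg n, ∀ η, d (ω * η) = d ω * η + (-1) ^ n * (ω * d η)
  generated : Algebra.adjoin k (Set.range ofA ∪ Set.range (fun a => d (ofA a))) = ⊤

attribute [instance] ExtAlg.ring ExtAlg.algebra ExtAlg.gradedMonoid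

variable {k : Type v} {A : Type u} [CommRing k] [Ring A] [Algebra k A]

namespace ExtAlg

variable (X : ExtAlg k A)

theorem ofA_mem (a : A) : X.ofA a ∈ X.deg 0 := by
  rw [← X.range_ofA]; exact ⟨a, rfl⟩

theorem mul_mem' {p q : ℕ} {x y : X.Ω} (hx : x ∈ X.deg p) (hy : y ∈ X.deg q) :
    x * y ∈ X.deg (p + q) := SetLike.mul_mem_graded hx hy

theorem ofA_mul_mem (a : A) {n : ℕ} {x : X.Ω} (hx : x ∈ X.deg n) : X.ofA a * x ∈ X.deg n := by
  simpa using X.mul_mem' (X.ofA_mem a) hx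

theorem mul_ofA_mem (a : A) {n : ℕ} {x : X.Ω} (hx : x ∈ X.deg n) : x * X.ofA a ∈ X.deg n := by
  simpa using X.mul_mem' hx (X.ofA_mem a)

theorem leibniz_ofA (a : A) (η : X.Ω) :
    X.d (X.ofA a * η) = X.d (X.ofA a) * η + X.ofA a * X.d η := by
  simpa using X.leibniz 0 _ (X.ofA_mem a) η

theorem d_one : X.d 1 = 0 := by
  have h := X.leibniz_ofA 1 1
  simpa using h

/-- The `A`-bimodule `Ωⁿ` of `n`-forms. -/
def Form (n : ℕ) : Type u := X.deg n

instance (n : ℕ) : AddCommGroup (X.Form n) := inferInstanceAs (AddCommGroup (X.deg n))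
instance (n : ℕ) : Module k (X.Form n) := inferInstanceAs (Module k (X.deg n))

/-- The inclusion of `Ωⁿ` in the total algebra. -/
def val (n : ℕ) : X.Form n →ₗ[k] X.Ω := (X.deg n).subtype

variable {X} in
theorem val_injective {n : ℕ} : Function.Injective (X.val n) := Subtype.val_injective

variable {X} in
theorem val_mem {n : ℕ} (ω : X.Form n) : X.val n ω ∈ X.deg n := ω.2

instance (n : ℕ) : SMul A (X.Form n) :=
  ⟨fun a ω => ⟨X.ofA a * X.val n ω, X.ofA_mul_mem a ω.2⟩⟩

instance (n : ℕ) : SMul Aᵐᵒᵖ (X.Form n) :=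
  ⟨fun a ω => ⟨X.val n ω * X.ofA a.unop, X.mul_ofA_mem a.unop ω.2⟩⟩

theorem val_smul (n : ℕ) (a : A) (ω : X.Form n) : X.val n (a • ω) = X.ofA a * X.val n ω := rfl

theorem val_op_smul (n : ℕ) (a : Aᵐᵒᵖ) (ω : X.Form n) :
    X.val n (a • ω) = X.val n ω * X.ofA a.unop := rfl

instance (n : ℕ) : Module A (X.Form n) where
  one_smul ω := val_injective (by simp [val_smul])
  mul_smul a b ω := val_injective (by simp [val_smul, mul_assoc])
  smul_zero a := val_injective (by simp [val_smul])
  smul_add a ω η := val_injective (by simp [val_smul, mul_add])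
  add_smul a b ω := val_injective (by simp [val_smul, add_mul])
  zero_smul ω := val_injective (by simp [val_smul])

instance (n : ℕ) : Module Aᵐᵒᵖ (X.Form n) where
  one_smul ω := val_injective (by simp [val_op_smul])
  mul_smul a b ω := val_injective (by simp [val_op_smul, mul_assoc])
  smul_zero a := val_injective (by simp [val_op_smul])
  smul_add a ω η := val_injective (by simp [val_op_smul, add_mul])
  add_smul a b ω := val_injective (by simp [val_op_smul, mul_add])
  zero_smul ω := val_injective (by simp [val_op_smul])

instance (n : ℕ) : SMulCommClass A Aᵐᵒᵖ (X.Form n) :=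
  ⟨fun a b ω => val_injective (by simp [val_smul, val_op_smul, mul_assoc])⟩

/-- The exterior algebra is flat as a right `A`-module: each `Ωⁿ` is. -/
def IsFlat : Prop := ∀ n, IsFlatRight A (X.Form n)

/-- The wedge product of forms. -/
def mulForm {p q : ℕ} (ω : X.Form p) (η : X.Form q) : X.Form (p + q) :=
  ⟨X.val p ω * X.val q η, X.mul_mem' (val_mem ω) (val_mem η)⟩

theorem val_mulForm {p q : ℕ} (ω : X.Form p) (η : X.Form q) :
    X.val (p + q) (X.mulForm ω η) = X.val p ω * X.val q η := rfl

/-- The exterior derivative `Ωⁿ → Ωⁿ⁺¹`. -/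
def dForm {n : ℕ} (ω : X.Form n) : X.Form (n + 1) :=
  ⟨X.d (X.val n ω), X.d_mem n _ (val_mem ω)⟩

/-- The unit `1 ∈ Ω⁰ = A`. -/
def oneForm : X.Form 0 := ⟨1, by simpa using X.ofA_mem 1⟩

section Wedge

variable (F : Type u) [AddCommGroup F] [Module A F]

/-- The map `Ωᵖ ⊗_A Ω^q ⊗_A F → Ω^(p+q) ⊗_A F`, `ω ⊗ η ⊗ f ↦ (ω ∧ η) ⊗ f`. -/
def wedge (p q : ℕ) : BT A (X.Form p) (BT A (X.Form q) F) →+ BT A (X.Form (p + q)) F :=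
  BT.lift₂ F (fun ω η => X.mulForm ω η)
    (fun _ _ _ => val_injective (by simp [val_mulForm, add_mul]))
    (fun _ _ _ => val_injective (by simp [val_mulForm, mul_add]))
    (fun _ _ _ => val_injective (by simp [val_mulForm, val_op_smul, val_smul, mul_assoc]))
    (fun _ _ _ => val_injective (by simp [val_mulForm, val_op_smul, mul_assoc]))

@[simp] theorem wedge_tmul (p q : ℕ) (ω : X.Form p) (η : X.Form q) (f : F) :
    X.wedge F p q (BT.tmul A ω (BT.tmul A η f)) = BT.tmul A (X.mulForm ω η) f := rfl

theorem wedge_smul (p q : ℕ) (a : A) (x : BT A (X.Form p) (BT A (X.Form q) F)) :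
    X.wedge F p q (a • x) = a • X.wedge F p q x := by
  induction x using BT.induction with
  | h0 => simp
  | ht ω y =>
    induction y using BT.induction with
    | h0 => simp [BT.tmul_zero]
    | ht η f =>
      rw [BT.smul_def, wedge_tmul, wedge_tmul, BT.smul_def]; congr 1
      exact val_injective (by simp [val_mulForm, val_smul, mul_assoc])
    | ha x y hx hy => simp only [BT.tmul_add, smul_add, map_add, hx, hy]
  | ha x y hx hy => simp only [smul_add, map_add, hx, hy]

end Wedge

/-! ### Symmetric forms and the `δ`-complex -/

/-- Two consecutive modules `Sⁿ E`, `Sⁿ⁺¹ E` of symmetric forms, with `Sⁿ⁺¹ E → Ω¹ ⊗_A Sⁿ E`. -/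
structure SymStage where
  prev : ModuleCat.{u} A
  cur : ModuleCat.{u} A
  incl : cur →ₗ[A] BT A (X.Form 1) prev

/-- The kernel of `Ω¹ Sⁿ⁺¹ E → Ω¹ Ω¹ Sⁿ E → Ω² Sⁿ E`, which is `Sⁿ⁺² E`. -/
def SymStage.ker {X : ExtAlg k A} (s : X.SymStage) : Submodule A (BT A (X.Form 1) s.cur) where
  carrier := {x | X.wedge s.prev 1 1 (BT.map (X.Form 1) s.incl x) = 0}
  zero_mem' := by simp
  add_mem' {x y} hx hy := by
    simp only [Set.mem_ofPred_eq, map_add] at *; rw [hx, hy, add_zero]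
  smul_mem' a x hx := by
    simp only [Set.mem_ofPred_eq] at *; rw [BT.map_smul, wedge_smul, hx, smul_zero]

/-- The passage from `(Sⁿ E, Sⁿ⁺¹ E)` to `(Sⁿ⁺¹ E, Sⁿ⁺² E)`. -/
def SymStage.next {X : ExtAlg k A} (s : X.SymStage) : X.SymStage where
  prev := s.cur
  cur := ModuleCat.of A s.ker
  incl := s.ker.subtype

section Sym

variable (E : Type u) [AddCommGroup E] [Module A E]

/-- The modules of symmetric forms with values in `E`, starting with `S⁰ E = E`,
`S¹ E = Ω¹ ⊗_A E`. -/
def symStage : ℕ → X.SymStage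
  | 0 => ⟨ModuleCat.of A E, ModuleCat.of A (BT A (X.Form 1) E), LinearMap.id⟩
  | n + 1 => (symStage n).next

/-- The module `Sⁿ E` of symmetric forms of degree `n`. -/
def Sym (n : ℕ) : Type u := (X.symStage E n).prev

instance (n : ℕ) : AddCommGroup (X.Sym E n) :=
  inferInstanceAs (AddCommGroup (X.symStage E n).prev)
instance (n : ℕ) : Module A (X.Sym E n) :=
  inferInstanceAs (Module A (X.symStage E n).prev)

/-- The canonical map `Sⁿ⁺¹ E → Ω¹ ⊗_A Sⁿ E`. -/
def symIncl (n : ℕ) : X.Sym E (n + 1) →ₗ[A] BT A (X.Form 1) (X.Sym E n) :=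
  (X.symStage E n).incl

theorem symIncl_wedge (n : ℕ) (s : X.Sym E (n + 2)) :
    X.wedge (X.Sym E n) 1 1 (BT.map (X.Form 1) (X.symIncl E n) (X.symIncl E (n + 1) s)) = 0 :=
  Subtype.property s

/-- The Spencer `δ`-operator `Ωᵐ Sⁿ⁺¹ E → Ωᵐ⁺¹ Sⁿ E`, `ω ⊗ s ↦ (-1)ᵐ ω ∧ s`. -/
def delta (n m : ℕ) :
    BT A (X.Form m) (X.Sym E (n + 1)) →+ BT A (X.Form (m + 1)) (X.Sym E n) :=
  ((-1 : ℤ) ^ m) • (X.wedge (X.Sym E n) m 1).comp (BT.map (X.Form m) (X.symIncl E n))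

theorem delta_delta (n m : ℕ) (x : BT A (X.Form m) (X.Sym E (n + 2))) :
    X.delta E n (m + 1) (X.delta E (n + 1) m x) = 0 := by
  have key : ∀ (ω : X.Form m) (y : BT A (X.Form 1) (X.Sym E (n + 1))),
      X.wedge (X.Sym E n) (m + 1) 1 (BT.map (X.Form (m + 1)) (X.symIncl E n)
        (X.wedge (X.Sym E (n + 1)) m 1 (BT.tmul A ω y))) =
      X.wedge (X.Sym E n) m 2 (BT.tmul A ω
        (X.wedge (X.Sym E n) 1 1 (BT.map (X.Form 1) (X.symIncl E n) y))) := by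
    intro ω y
    induction y using BT.induction with
    | h0 => simp [BT.tmul_zero]
    | ht η s =>
      rw [wedge_tmul, BT.map_tmul, BT.map_tmul]
      generalize X.symIncl E n s = z
      induction z using BT.induction with
      | h0 => simp [BT.tmul_zero]
      | ht θ t =>
        simp only [wedge_tmul]
        refine congrArg (fun w : X.Form (m + 2) => BT.tmul A w t) (val_injective ?_)
        exact mul_assoc _ _ _
      | ha x y hx hy => simp only [BT.tmul_add, map_add, hx, hy]
    | ha x y hx hy => simp only [BT.tmul_add, map_add, hx, hy]
  have h0 : X.wedge (X.Sym E n) (m + 1) 1 (BT.map (X.Form (m + 1)) (X.symIncl E n)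
        (X.wedge (X.Sym E (n + 1)) m 1 (BT.map (X.Form m) (X.symIncl E (n + 1)) x))) = 0 := by
    induction x using BT.induction with
    | h0 => simp
    | ht ω s => rw [BT.map_tmul, key, symIncl_wedge, BT.tmul_zero, map_zero]
    | ha x y hx hy => simp only [map_add, hx, hy, add_zero]
  simp only [delta, AddMonoidHom.smul_apply, AddMonoidHom.comp_apply, map_zsmul, h0, smul_zero]

/-- The cocycles of the `δ`-complex `0 → Sⁿ E → Ω¹ Sⁿ⁻¹ E → ⋯ → Ωⁿ ⊗_A E → 0` in `Ωᵐ Sⁿ E`. -/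
def deltaKer : (n m : ℕ) → AddSubgroup (BT A (X.Form m) (X.Sym E n))
  | 0, _ => ⊤
  | n + 1, m => (X.delta E n m).ker

/-- The coboundaries of the `δ`-complex in `Ωᵐ Sⁿ E`. -/
def deltaIm : (n m : ℕ) → AddSubgroup (BT A (X.Form m) (X.Sym E n))
  | _, 0 => ⊥
  | n, m + 1 => (X.delta E n m).range

theorem deltaIm_le_deltaKer : ∀ n m, X.deltaIm E n m ≤ X.deltaKer E n m
  | 0, _ => le_top
  | _ + 1, 0 => bot_le
  | n + 1, m + 1 => by
    rintro _ ⟨x, rfl⟩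
    exact X.delta_delta E n m x

/-- The Spencer `δ`-cohomology `H_δ^{n,m}(E)` at `Ωᵐ Sⁿ E`. -/
abbrev DeltaCohomology (n m : ℕ) : Type u :=
  X.deltaKer E n m ⧸ (X.deltaIm E n m).addSubgroupOf (X.deltaKer E n m)

end Sym

/-! ### The bimodule of 1-jets -/

/-- The map `A ⊗ A → Ω¹`, `a ⊗ b ↦ a db`. -/
def adb : A ⊗[k] A →ₗ[k] X.Ω :=
  LinearMap.mul' k X.Ω ∘ₗ TensorProduct.map X.ofA.toLinearMap (X.d ∘ₗ X.ofA.toLinearMap)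

@[simp] theorem adb_tmul (a b : A) : X.adb (a ⊗ₜ b) = X.ofA a * X.d (X.ofA b) := by
  simp [adb]

theorem mul'_smul (a : A) (x : A ⊗[k] A) :
    LinearMap.mul' k A (a • x) = a * LinearMap.mul' k A x := by
  induction x using TensorProduct.induction_on with
  | zero => simp
  | tmul b c => simp [TensorProduct.smul_tmul', mul_assoc]
  | add x y hx hy => simp only [smul_add, map_add, mul_add, hx, hy]

theorem adb_smul (a : A) (x : A ⊗[k] A) : X.adb (a • x) = X.ofA a * X.adb x := by
  induction x using TensorProduct.induction_on with
  | zero => simp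
  | tmul b c => simp [TensorProduct.smul_tmul', mul_assoc]
  | add x y hx hy => simp only [smul_add, map_add, mul_add, hx, hy]

/-- The sub-bimodule `N = {∑ aᵢ ⊗ bᵢ | ∑ aᵢ bᵢ = 0, ∑ aᵢ dbᵢ = 0}` of `A ⊗ A`. -/
def jetRel : Submodule A (A ⊗[k] A) where
  carrier := {x | LinearMap.mul' k A x = 0 ∧ X.adb x = 0}
  zero_mem' := by simp
  add_mem' {x y} hx hy := by
    simp only [Set.mem_ofPred_eq, map_add] at *; simp [hx, hy]
  smul_mem' a x hx := by
    simp only [Set.mem_ofPred_eq] at *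
    rw [mul'_smul, adb_smul, hx.1, hx.2, mul_zero, mul_zero]; exact ⟨rfl, rfl⟩

/-- Right multiplication by `c` on `A ⊗ A`: `a ⊗ b ↦ a ⊗ b c`. -/
def rmul (c : A) : A ⊗[k] A →ₗ[A] A ⊗[k] A :=
  TensorProduct.AlgebraTensorModule.map LinearMap.id (LinearMap.mulRight k c)

@[simp] theorem rmul_tmul (c a b : A) : rmul (k := k) c (a ⊗ₜ b) = a ⊗ₜ (b * c) := rfl

theorem mul'_rmul (c : A) (x : A ⊗[k] A) :
    LinearMap.mul' k A (rmul c x) = LinearMap.mul' k A x * c := by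
  induction x using TensorProduct.induction_on with
  | zero => simp
  | tmul a b => simp [mul_assoc]
  | add x y hx hy => simp only [map_add, add_mul, hx, hy]

theorem adb_rmul (c : A) (x : A ⊗[k] A) : X.adb (rmul c x) =
    X.adb x * X.ofA c + X.ofA (LinearMap.mul' k A x) * X.d (X.ofA c) := by
  induction x using TensorProduct.induction_on with
  | zero => simp
  | tmul a b => simp [leibniz_ofA, mul_add, mul_assoc]
  | add x y hx hy => simp only [map_add, add_mul, hx, hy]; abel

theorem jetRel_le_comap_rmul (c : A) : X.jetRel ≤ X.jetRel.comap (rmul c) := by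
  intro x hx
  refine ⟨?_, ?_⟩
  · rw [mul'_rmul, hx.1, zero_mul]
  · rw [adb_rmul, hx.1, hx.2]; simp

/-- The bimodule `J¹ A = (A ⊗ A) / N` of 1-jets. -/
def J1 : Type u := (A ⊗[k] A) ⧸ X.jetRel

instance : AddCommGroup X.J1 := inferInstanceAs (AddCommGroup ((A ⊗[k] A) ⧸ X.jetRel))
instance : Module A X.J1 := inferInstanceAs (Module A ((A ⊗[k] A) ⧸ X.jetRel))

/-- The class `[x]` in `J¹ A` of `x ∈ A ⊗ A`. -/
def jmk : A ⊗[k] A →ₗ[A] X.J1 := X.jetRel.mkQ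

/-- The right action `[a ⊗ b] c = [a ⊗ b c]` on `J¹ A`. -/
def j1Right (c : A) : X.J1 →ₗ[A] X.J1 :=
  X.jetRel.mapQ X.jetRel (rmul c) (X.jetRel_le_comap_rmul c)

instance : SMul Aᵐᵒᵖ X.J1 := ⟨fun c x => X.j1Right c.unop x⟩

theorem smul_jmk_tmul (c a b : A) : c • X.jmk (a ⊗ₜ b) = X.jmk ((c * a) ⊗ₜ b) := rfl

variable {X} in
@[elab_as_elim]
theorem J1.induction {P : X.J1 → Prop} (p : X.J1) (h0 : P 0)
    (ht : ∀ a b, P (X.jmk (a ⊗ₜ b))) (ha : ∀ p q, P p → P q → P (p + q)) : P p := by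
  obtain ⟨x, rfl⟩ := X.jetRel.mkQ_surjective p
  induction x using TensorProduct.induction_on with
  | zero => rw [map_zero]; exact h0
  | tmul a b => exact ht a b
  | add x y hx hy => rw [map_add]; exact ha _ _ hx hy

theorem op_smul_add' (c : Aᵐᵒᵖ) (p q : X.J1) : c • (p + q) = c • p + c • q :=
  map_add (X.j1Right c.unop) p q

theorem op_smul_zero' (c : Aᵐᵒᵖ) : c • (0 : X.J1) = 0 := map_zero (X.j1Right c.unop)

theorem op_smul_tmul (c : Aᵐᵒᵖ) (a b : A) :
    c • X.jmk (a ⊗ₜ b) = X.jmk (a ⊗ₜ (b * c.unop)) := rfl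

instance : Module Aᵐᵒᵖ X.J1 where
  smul_zero := X.op_smul_zero'
  smul_add := X.op_smul_add'
  one_smul p := by
    induction p using J1.induction with
    | h0 => exact op_smul_zero' _ _
    | ht a b => simp [op_smul_tmul]
    | ha p q hp hq => rw [op_smul_add', hp, hq]
  mul_smul c c' p := by
    induction p using J1.induction with
    | h0 => simp only [op_smul_zero']
    | ht a b => simp [op_smul_tmul, mul_assoc]
    | ha p q hp hq => simp only [op_smul_add', hp, hq]
  add_smul c c' p := by
    induction p using J1.induction with
    | h0 => simp only [op_smul_zero', add_zero]
    | ht a b => simp [op_smul_tmul, mul_add, TensorProduct.tmul_add]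
    | ha p q hp hq => simp only [op_smul_add', hp, hq]; abel
  zero_smul p := by
    induction p using J1.induction with
    | h0 => exact op_smul_zero' _ _
    | ht a b => simp [op_smul_tmul]
    | ha p q hp hq => rw [op_smul_add', hp, hq, add_zero]

instance : SMulCommClass A Aᵐᵒᵖ X.J1 := ⟨fun a c p => ((X.j1Right c.unop).map_smul a p).symm⟩

/-- The additive map on `J¹ A` given by a map on `A ⊗ A` that vanishes on the relations. -/
def descend (n : ℕ) (f : A ⊗[k] A →ₗ[k] X.Ω) (hm : ∀ x, f x ∈ X.deg n)
    (h : ∀ x ∈ X.jetRel, f x = 0) : X.J1 →+ X.Form n :=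
  QuotientAddGroup.lift X.jetRel.toAddSubgroup (f.codRestrict (X.deg n) hm).toAddMonoidHom
    (fun x hx => val_injective (h x hx))

@[simp] theorem val_descend (n : ℕ) (f : A ⊗[k] A →ₗ[k] X.Ω) (hm) (h) (x : A ⊗[k] A) :
    X.val n (X.descend n f hm h (X.jmk x)) = f x := rfl

theorem mem_of_tmul {n : ℕ} (f : A ⊗[k] A →ₗ[k] X.Ω) (h : ∀ a b, f (a ⊗ₜ b) ∈ X.deg n)
    (x : A ⊗[k] A) : f x ∈ X.deg n := by
  induction x using TensorProduct.induction_on with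
  | zero => simp
  | tmul a b => exact h a b
  | add x y hx hy => rw [map_add]; exact add_mem hx hy

/-! ### The Spencer operator on 1-jets -/

/-- The map `A ⊗ A → Ω`, `a ⊗ b ↦ d(ω a) b`. -/
def preSpencer (ω : X.Ω) : A ⊗[k] A →ₗ[k] X.Ω :=
  LinearMap.mul' k X.Ω ∘ₗ
    TensorProduct.map (X.d ∘ₗ LinearMap.mulLeft k ω ∘ₗ X.ofA.toLinearMap) X.ofA.toLinearMap

@[simp] theorem preSpencer_tmul (ω : X.Ω) (a b : A) :
    X.preSpencer ω (a ⊗ₜ b) = X.d (ω * X.ofA a) * X.ofA b := by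
  simp [preSpencer]

theorem preSpencer_eq {m : ℕ} {ω : X.Ω} (hω : ω ∈ X.deg m) (x : A ⊗[k] A) :
    X.preSpencer ω x = X.d ω * X.ofA (LinearMap.mul' k A x) +
      (-1) ^ m * (ω * (X.d (X.ofA (LinearMap.mul' k A x)) - X.adb x)) := by
  induction x using TensorProduct.induction_on with
  | zero => simp
  | tmul a b =>
    simp [X.leibniz m ω hω, leibniz_ofA, add_mul, mul_assoc]
  | add x y hx hy => simp only [map_add, hx, hy]; noncomm_ring

/-- The map `Ωᵐ × J¹ A → Ωᵐ⁺¹`, `(ω, [a ⊗ b]) ↦ d(ω a) b`. -/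
def spencerForm {m : ℕ} (ω : X.Form m) : X.J1 →+ X.Form (m + 1) :=
  X.descend (m + 1) (X.preSpencer (X.val m ω))
    (X.mem_of_tmul _ fun a b => by
      rw [preSpencer_tmul]
      exact X.mul_ofA_mem b (X.d_mem m _ (X.mul_ofA_mem a (val_mem ω))))
    (fun x hx => by rw [X.preSpencer_eq (val_mem ω), hx.1, hx.2]; simp)

theorem val_spencerForm {m : ℕ} (ω : X.Form m) (a b : A) :
    X.val (m + 1) (X.spencerForm ω (X.jmk (a ⊗ₜ b))) =
      X.d (X.val m ω * X.ofA a) * X.ofA b := by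
  rw [spencerForm, val_descend, preSpencer_tmul]

theorem spencerForm_add {m : ℕ} (ω ω' : X.Form m) (p : X.J1) :
    X.spencerForm (ω + ω') p = X.spencerForm ω p + X.spencerForm ω' p := by
  induction p using J1.induction with
  | h0 => simp
  | ht a b => exact val_injective (by simp [val_spencerForm, add_mul])
  | ha p q hp hq => simp only [map_add, hp, hq]; abel

theorem spencerForm_zero {m : ℕ} (p : X.J1) : X.spencerForm (0 : X.Form m) p = 0 := by
  have h := X.spencerForm_add (0 : X.Form m) 0 p
  rwa [add_zero, left_eq_add] at h

/-- The Spencer operator `Ωᵐ J¹ F → Ωᵐ⁺¹ F`, `ω ⊗ [a ⊗ b] ⊗ f ↦ d(ω a) b ⊗ f`. -/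
def spencerOne (F : Type u) [AddCommGroup F] [Module A F] (m : ℕ) :
    BT A (X.Form m) (BT A X.J1 F) →+ BT A (X.Form (m + 1)) F :=
  BT.lift₂ F (fun ω p => X.spencerForm ω p)
    X.spencerForm_add
    (fun _ _ _ => map_add _ _ _)
    (fun ω c p => by
      induction p using J1.induction with
      | h0 => simp
      | ht a b => exact val_injective (by
          simp [val_spencerForm, val_op_smul, smul_jmk_tmul, mul_assoc])
      | ha p q hp hq => simp only [map_add, smul_add, hp, hq])
    (fun ω c p => by
      induction p using J1.induction with
      | h0 => simp
      | ht a b => exact val_injective (by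
          simp [val_spencerForm, val_op_smul, op_smul_tmul, mul_assoc])
      | ha p q hp hq => simp only [map_add, smul_add, hp, hq])

@[simp] theorem spencerOne_tmul (F : Type u) [AddCommGroup F] [Module A F] (m : ℕ)
    (ω : X.Form m) (p : X.J1) (f : F) :
    X.spencerOne F m (BT.tmul A ω (BT.tmul A p f)) = BT.tmul A (X.spencerForm ω p) f := rfl

/-! ### The operator whose kernel cuts out the holonomic jets -/

/-- The map `J¹ A → Ω¹`, `[a ⊗ b] ↦ (da) b`. -/
def dab (p : X.J1) : X.Ω := X.val 1 (X.spencerForm X.oneForm p)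

@[simp] theorem dab_jmk (a b : A) : X.dab (X.jmk (a ⊗ₜ b)) = X.d (X.ofA a) * X.ofA b := by
  refine (X.val_spencerForm X.oneForm a b).trans ?_
  change X.d (1 * X.ofA a) * X.ofA b = _
  rw [one_mul]

theorem dab_add (p q : X.J1) : X.dab (p + q) = X.dab p + X.dab q := by
  simp [dab]

@[simp] theorem dab_zero : X.dab 0 = 0 := by simp [dab]

theorem dab_mem (p : X.J1) : X.dab p ∈ X.deg 1 := val_mem _

theorem dab_op_smul (c : A) (p : X.J1) : X.dab (op c • p) = X.dab p * X.ofA c := by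
  induction p using J1.induction with
  | h0 => simp
  | ht a b => simp [op_smul_tmul, mul_assoc]
  | ha p q hp hq => simp only [smul_add, dab_add, add_mul, hp, hq]

/-- The product map `J¹ A → A`, `[a ⊗ b] ↦ a b`. -/
def jproj : X.J1 →+ A :=
  QuotientAddGroup.lift X.jetRel.toAddSubgroup (LinearMap.mul' k A).toAddMonoidHom
    (fun _ hx => hx.1)

@[simp] theorem jproj_jmk (a b : A) : X.jproj (X.jmk (a ⊗ₜ b)) = a * b :=
  LinearMap.mul'_apply (R := k)

theorem dab_smul (b : A) (q : X.J1) :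
    X.dab (b • q) = X.ofA b * X.dab q + X.d (X.ofA b) * X.ofA (X.jproj q) := by
  induction q using J1.induction with
  | h0 => simp
  | ht c f => simp [smul_jmk_tmul, leibniz_ofA, add_mul, mul_assoc, add_comm]
  | ha p q hp hq => simp only [smul_add, dab_add, map_add, mul_add, hp, hq]; abel

/-- For `q ∈ J¹ A`, the map `A → Ω¹`, `b ↦ dab (b q)`; for `q = [c ⊗ f]` it is
`b ↦ d(b c) f`. -/
def dabLeft (q : X.J1) : A →ₗ[k] X.Ω where
  toFun b := X.dab (b • q)
  map_add' b b' := by rw [add_smul, dab_add]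
  map_smul' r b := by
    simp only [dab_smul, map_smul, smul_add, smul_mul_assoc, RingHom.id_apply]

@[simp] theorem dabLeft_apply (q : X.J1) (b : A) : X.dabLeft q b = X.dab (b • q) := rfl

/-- For `q = [c ⊗ f]`, the map `A ⊗ A → Ω¹`, `a ⊗ b ↦ a d(b c) f`. -/
def preDI (q : X.J1) : A ⊗[k] A →ₗ[k] X.Ω :=
  LinearMap.mul' k X.Ω ∘ₗ TensorProduct.map X.ofA.toLinearMap (X.dabLeft q)

/-- For `q = [c ⊗ f]`, the map `A ⊗ A → Ω²`, `a ⊗ b ↦ da ∧ d(b c) f`. -/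
def preDII (q : X.J1) : A ⊗[k] A →ₗ[k] X.Ω :=
  LinearMap.mul' k X.Ω ∘ₗ TensorProduct.map (X.d ∘ₗ X.ofA.toLinearMap) (X.dabLeft q)

@[simp] theorem preDI_tmul (q : X.J1) (a b : A) :
    X.preDI q (a ⊗ₜ b) = X.ofA a * X.dab (b • q) := by simp [preDI]

@[simp] theorem preDII_tmul (q : X.J1) (a b : A) :
    X.preDII q (a ⊗ₜ b) = X.d (X.ofA a) * X.dab (b • q) := by simp [preDII]

theorem preDI_eq (q : X.J1) (x : A ⊗[k] A) : X.preDI q x =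
    X.ofA (LinearMap.mul' k A x) * X.dab q + X.adb x * X.ofA (X.jproj q) := by
  induction x using TensorProduct.induction_on with
  | zero => simp
  | tmul a b => simp [dab_smul, mul_add, mul_assoc]
  | add x y hx hy => simp only [map_add, hx, hy]; noncomm_ring

theorem preDII_eq (q : X.J1) (x : A ⊗[k] A) : X.preDII q x =
    (X.d (X.ofA (LinearMap.mul' k A x)) - X.adb x) * X.dab q +
      X.d (X.adb x) * X.ofA (X.jproj q) := by
  induction x using TensorProduct.induction_on with
  | zero => simp
  | tmul a b => simp [dab_smul, leibniz_ofA, mul_add, X.d_d, mul_assoc]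
  | add x y hx hy => simp only [map_add, hx, hy]; noncomm_ring

/-- The map `J¹ A × J¹ A → Ω¹`, `([a ⊗ b], [c ⊗ f]) ↦ a d(b c) f`. -/
def formDI (q : X.J1) : X.J1 →+ X.Form 1 :=
  X.descend 1 (X.preDI q)
    (X.mem_of_tmul _ fun a b => by
      rw [preDI_tmul]; exact X.ofA_mul_mem a (X.dab_mem _))
    (fun x hx => by rw [preDI_eq, hx.1, hx.2]; simp)

/-- The map `J¹ A × J¹ A → Ω²`, `([a ⊗ b], [c ⊗ f]) ↦ da ∧ d(b c) f`. -/
def formDII (q : X.J1) : X.J1 →+ X.Form 2 :=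
  X.descend 2 (X.preDII q)
    (X.mem_of_tmul _ fun a b => by
      rw [preDII_tmul]
      exact X.mul_mem' (p := 1) (q := 1) (X.d_mem 0 _ (X.ofA_mem a)) (X.dab_mem _))
    (fun x hx => by rw [preDII_eq, hx.1, hx.2]; simp)

theorem val_formDI (q : X.J1) (a b : A) :
    X.val 1 (X.formDI q (X.jmk (a ⊗ₜ b))) = X.ofA a * X.dab (b • q) := by
  rw [formDI, val_descend, preDI_tmul]

theorem val_formDII (q : X.J1) (a b : A) :
    X.val 2 (X.formDII q (X.jmk (a ⊗ₜ b))) = X.d (X.ofA a) * X.dab (b • q) := by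
  rw [formDII, val_descend, preDII_tmul]

theorem formDI_add (q q' p : X.J1) :
    X.formDI (q + q') p = X.formDI q p + X.formDI q' p := by
  induction p using J1.induction with
  | h0 => simp
  | ht a b => exact val_injective (by simp [val_formDI, dab_add, mul_add])
  | ha p q hp hq => simp only [map_add, hp, hq]; abel

theorem formDI_zero (p : X.J1) : X.formDI 0 p = 0 := by
  have h := X.formDI_add 0 0 p
  rwa [add_zero, left_eq_add] at h

theorem formDII_add (q q' p : X.J1) :
    X.formDII (q + q') p = X.formDII q p + X.formDII q' p := by
  induction p using J1.induction with
  | h0 => simp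
  | ht a b => exact val_injective (by simp [val_formDII, dab_add, mul_add])
  | ha p q hp hq => simp only [map_add, hp, hq]; abel

theorem formDII_zero (p : X.J1) : X.formDII 0 p = 0 := by
  have h := X.formDII_add 0 0 p
  rwa [add_zero, left_eq_add] at h

theorem spencerForm_spencerForm {m : ℕ} (ω : X.Form m) (p q : X.J1) :
    X.val (m + 2) (X.spencerForm (X.spencerForm ω p) q) =
      (-1) ^ (m + 1) * (X.d (X.val m ω) * X.val 1 (X.formDI q p)) -
        X.val m ω * X.val 2 (X.formDII q p) := by
  induction p using J1.induction with
  | h0 => rw [map_zero, spencerForm_zero]; simp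
  | ha p p' hp hp' =>
    rw [map_add, spencerForm_add, map_add, hp, hp']; simp only [map_add]; noncomm_ring
  | ht a b =>
    induction q using J1.induction with
    | h0 => simp [formDI_zero, formDII_zero]
    | ha q q' hq hq' =>
      rw [map_add, map_add, hq, hq', formDI_add, formDII_add]; simp only [map_add]; noncomm_ring
    | ht c f =>
      rw [val_spencerForm, val_spencerForm, val_formDI, val_formDII, smul_jmk_tmul, dab_jmk,
        mul_assoc (X.d _), ← map_mul,
        X.leibniz (m + 1) _ (X.d_mem m _ (X.mul_ofA_mem a (val_mem ω))), X.d_d,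
        X.leibniz m _ (val_mem ω)]
      rcases neg_one_pow_eq_or X.Ω m with h | h <;> rw [pow_succ, h] <;> noncomm_ring

section Holonomic

variable (F : Type u) [AddCommGroup F] [Module A F]

/-- The `Ω¹`-component `J¹ J¹ F → Ω¹ F`,
`[a ⊗ b] ⊗ [c ⊗ f] ⊗ e ↦ a d(b c) f ⊗ e`, of the operator that defines holonomic jets. -/
def DI : BT A X.J1 (BT A X.J1 F) →+ BT A (X.Form 1) F :=
  BT.lift₂ F (fun p q => X.formDI q p)
    (fun _ _ _ => map_add _ _ _)
    (fun p q q' => X.formDI_add q q' p)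
    (fun p c q => by
      induction p using J1.induction with
      | h0 => simp
      | ht a b => exact val_injective (by simp [val_formDI, op_smul_tmul, mul_smul])
      | ha p q hp hq => simp only [map_add, smul_add, hp, hq])
    (fun p c q => by
      induction p using J1.induction with
      | h0 => simp
      | ht a b => exact val_injective (by
          rw [val_formDI, smul_comm, dab_op_smul, val_op_smul, val_formDI, unop_op, mul_assoc])
      | ha p q hp hq => simp only [map_add, smul_add, hp, hq])

/-- The `Ω²`-component `J¹ J¹ F → Ω² F`,
`[a ⊗ b] ⊗ [c ⊗ f] ⊗ e ↦ da ∧ d(b c) f ⊗ e`, of the operator that defines holonomic jets. -/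
def DII : BT A X.J1 (BT A X.J1 F) →+ BT A (X.Form 2) F :=
  BT.lift₂ F (fun p q => X.formDII q p)
    (fun _ _ _ => map_add _ _ _)
    (fun p q q' => X.formDII_add q q' p)
    (fun p c q => by
      induction p using J1.induction with
      | h0 => simp
      | ht a b => exact val_injective (by simp [val_formDII, op_smul_tmul, mul_smul])
      | ha p q hp hq => simp only [map_add, smul_add, hp, hq])
    (fun p c q => by
      induction p using J1.induction with
      | h0 => simp
      | ht a b => exact val_injective (by
          rw [val_formDII, smul_comm, dab_op_smul, val_op_smul, val_formDII, unop_op, mul_assoc])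
      | ha p q hp hq => simp only [map_add, smul_add, hp, hq])

@[simp] theorem DI_tmul (p q : X.J1) (e : F) :
    X.DI F (BT.tmul A p (BT.tmul A q e)) = BT.tmul A (X.formDI q p) e := rfl

@[simp] theorem DII_tmul (p q : X.J1) (e : F) :
    X.DII F (BT.tmul A p (BT.tmul A q e)) = BT.tmul A (X.formDII q p) e := rfl

theorem DI_smul (c : A) (x : BT A X.J1 (BT A X.J1 F)) : X.DI F (c • x) = c • X.DI F x := by
  induction x using BT.induction with
  | h0 => simp
  | ha x y hx hy => simp only [smul_add, map_add, hx, hy]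
  | ht p y =>
    induction y using BT.induction with
    | h0 => simp [BT.tmul_zero]
    | ha x y hx hy => simp only [BT.tmul_add, smul_add, map_add, hx, hy]
    | ht q e =>
      rw [BT.smul_def, DI_tmul, DI_tmul, BT.smul_def]; congr 1
      induction p using J1.induction with
      | h0 => simp
      | ht a b => exact val_injective (by
          simp [val_formDI, smul_jmk_tmul, val_smul, mul_assoc])
      | ha p q hp hq => simp only [map_add, smul_add, hp, hq]

/-- The differential `dc ∈ Ω¹` of `c ∈ A`. -/
def dA (c : A) : X.Form 1 := ⟨X.d (X.ofA c), X.d_mem 0 _ (X.ofA_mem c)⟩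

theorem val_dA (c : A) : X.val 1 (X.dA c) = X.d (X.ofA c) := rfl

theorem DII_smul (c : A) (x : BT A X.J1 (BT A X.J1 F)) :
    X.DII F (c • x) = c • X.DII F x + X.wedge F 1 1 (BT.tmul A (X.dA c) (X.DI F x)) := by
  induction x using BT.induction with
  | h0 => simp [BT.tmul_zero]
  | ha x y hx hy => simp only [smul_add, map_add, BT.tmul_add, hx, hy]; abel
  | ht p y =>
    induction y using BT.induction with
    | h0 => simp [BT.tmul_zero]
    | ha x y hx hy => simp only [BT.tmul_add, smul_add, map_add, hx, hy]; abel
    | ht q e =>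
      rw [BT.smul_def, DII_tmul, DII_tmul, BT.smul_def, DI_tmul, wedge_tmul]
      refine Eq.trans ?_ (BT.add_tmul (M := X.Form 2) A _ _ e)
      congr 1
      refine val_injective ?_
      rw [map_add]
      change _ = _ + X.d (X.ofA c) * X.val 1 (X.formDI q p)
      induction p using J1.induction with
      | h0 => simp
      | ht a b =>
        simp [val_formDI, val_formDII, smul_jmk_tmul, val_smul, leibniz_ofA, add_mul, mul_assoc,
          add_comm]
      | ha p p' hp hp' => simp only [map_add, smul_add, hp, hp', mul_add]; abel

theorem spencerOne_spencerOne (m : ℕ) (ω : X.Form m) (x : BT A X.J1 (BT A X.J1 F)) :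
    X.spencerOne F (m + 1) (X.spencerOne (BT A X.J1 F) m (BT.tmul A ω x)) =
      (-1 : ℤ) ^ (m + 1) • X.wedge F (m + 1) 1 (BT.tmul A (X.dForm ω) (X.DI F x)) -
        X.wedge F m 2 (BT.tmul A ω (X.DII F x)) := by
  induction x using BT.induction with
  | h0 => simp [BT.tmul_zero]
  | ha x y hx hy => simp only [map_add, BT.tmul_add, hx, hy, smul_add]; abel
  | ht p y =>
    induction y using BT.induction with
    | h0 => simp [BT.tmul_zero]
    | ha x y hx hy => simp only [map_add, BT.tmul_add, hx, hy, smul_add]; abel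
    | ht q e =>
      rw [spencerOne_tmul, spencerOne_tmul, DI_tmul, DII_tmul, wedge_tmul, wedge_tmul]
      have key : X.spencerForm (X.spencerForm ω p) q =
          (-1 : ℤ) ^ (m + 1) • X.mulForm (p := m + 1) (q := 1) (X.dForm ω) (X.formDI q p) -
            X.mulForm (p := m) (q := 2) ω (X.formDII q p) := by
        refine val_injective ((X.spencerForm_spencerForm ω p q).trans ?_)
        refine Eq.trans ?_ (map_sub (X.val (m + 2)) _ _).symm
        refine congrArg₂ (· - ·) ?_ rfl
        refine Eq.trans ?_ (map_zsmul (X.val (m + 2)) _ _).symm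
        change _ = (-1 : ℤ) ^ (m + 1) • (X.d (X.val m ω) * X.val 1 (X.formDI q p))
        rw [zsmul_eq_mul]; push_cast; rfl
      let τ : X.Form (m + 2) →+ BT A (X.Form (m + 2)) F :=
        AddMonoidHom.mk' (fun w => BT.tmul A w e) (fun _ _ => BT.add_tmul A _ _ _)
      refine (congrArg τ key).trans ?_
      refine (map_sub τ _ _).trans (congrArg₂ (· - ·) (map_zsmul τ _ _) rfl)

end Holonomic

/-! ### Holonomic jets and the Spencer complex -/

/-- Two consecutive jet modules `Jⁿ E`, `Jⁿ⁺¹ E`, with `Jⁿ⁺¹ E → J¹ Jⁿ E`. -/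
structure JetStage where
  prev : ModuleCat.{u} A
  cur : ModuleCat.{u} A
  incl : cur →ₗ[A] BT A X.J1 prev

/-- The kernel of `J¹ Jⁿ⁺¹ E → J¹ J¹ Jⁿ E → (Ω¹ ⋉ Ω²) Jⁿ E`, which is `Jⁿ⁺² E`. -/
def JetStage.ker {X : ExtAlg k A} (s : X.JetStage) : Submodule A (BT A X.J1 s.cur) where
  carrier := {x | X.DI s.prev (BT.map X.J1 s.incl x) = 0 ∧
    X.DII s.prev (BT.map X.J1 s.incl x) = 0}
  zero_mem' := by simp
  add_mem' {x y} hx hy := by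
    simp only [Set.mem_ofPred_eq, map_add] at *; simp [hx, hy]
  smul_mem' a x hx := by
    simp only [Set.mem_ofPred_eq] at *
    rw [BT.map_smul, DI_smul, DII_smul, hx.1, hx.2, BT.tmul_zero]; simp

/-- The passage from `(Jⁿ E, Jⁿ⁺¹ E)` to `(Jⁿ⁺¹ E, Jⁿ⁺² E)`. -/
def JetStage.next {X : ExtAlg k A} (s : X.JetStage) : X.JetStage where
  prev := s.cur
  cur := ModuleCat.of A s.ker
  incl := s.ker.subtype

section Jet

variable (E : Type u) [AddCommGroup E] [Module A E]

/-- The jet modules of `E`, starting with `J⁰ E = E`, `J¹ E = J¹ A ⊗_A E`. -/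
def jetStage : ℕ → X.JetStage
  | 0 => ⟨ModuleCat.of A E, ModuleCat.of A (BT A X.J1 E), LinearMap.id⟩
  | n + 1 => (jetStage n).next

/-- The module `Jⁿ E` of holonomic `n`-jets. -/
def Jet (n : ℕ) : Type u := (X.jetStage E n).prev

instance (n : ℕ) : AddCommGroup (X.Jet E n) :=
  inferInstanceAs (AddCommGroup (X.jetStage E n).prev)
instance (n : ℕ) : Module A (X.Jet E n) :=
  inferInstanceAs (Module A (X.jetStage E n).prev)

/-- The canonical map `Jⁿ⁺¹ E → J¹ Jⁿ E`. -/
def jetIncl (n : ℕ) : X.Jet E (n + 1) →ₗ[A] BT A X.J1 (X.Jet E n) :=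
  (X.jetStage E n).incl

theorem jetIncl_DI (n : ℕ) (ξ : X.Jet E (n + 2)) :
    X.DI (X.Jet E n) (BT.map X.J1 (X.jetIncl E n) (X.jetIncl E (n + 1) ξ)) = 0 :=
  (Subtype.property ξ).1

theorem jetIncl_DII (n : ℕ) (ξ : X.Jet E (n + 2)) :
    X.DII (X.Jet E n) (BT.map X.J1 (X.jetIncl E n) (X.jetIncl E (n + 1) ξ)) = 0 :=
  (Subtype.property ξ).2

variable {E} in
/-- The 1-jet prolongation `E → J¹ E`, `e ↦ [1 ⊗ 1] ⊗ e`. -/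
def prolongOne : E →+ BT A X.J1 E :=
  AddMonoidHom.mk' (fun e => BT.tmul A (X.jmk (1 ⊗ₜ 1)) e) (BT.tmul_add A _)

theorem prolongOne_mem (s : X.JetStage) (x : s.cur) (y : s.prev)
    (h : s.incl x = X.prolongOne y) : X.prolongOne x ∈ s.ker := by
  change X.DI s.prev (BT.map X.J1 s.incl (BT.tmul A (X.jmk (1 ⊗ₜ 1)) x)) = 0 ∧
    X.DII s.prev (BT.map X.J1 s.incl (BT.tmul A (X.jmk (1 ⊗ₜ 1)) x)) = 0
  rw [BT.map_tmul, h]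
  change X.DI s.prev (BT.tmul A _ (BT.tmul A _ y)) = 0 ∧
    X.DII s.prev (BT.tmul A _ (BT.tmul A _ y)) = 0
  rw [DI_tmul, DII_tmul]
  have h1 : X.formDI (X.jmk (1 ⊗ₜ 1)) (X.jmk (1 ⊗ₜ 1)) = 0 :=
    val_injective (by simp [val_formDI, d_one])
  have h2 : X.formDII (X.jmk (1 ⊗ₜ 1)) (X.jmk (1 ⊗ₜ 1)) = 0 :=
    val_injective (by simp [val_formDII, d_one])
  rw [h1, h2, BT.zero_tmul, BT.zero_tmul]; exact ⟨rfl, rfl⟩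

/-- The prolongations `jⁿ : E → Jⁿ E` and `jⁿ⁺¹ : E → Jⁿ⁺¹ E`, where `jⁿ⁺¹` is the
corestriction of `E → Jⁿ E → J¹ Jⁿ E`. -/
def prolongPair : (n : ℕ) → {p : (E →+ X.Jet E n) × (E →+ X.Jet E (n + 1)) //
    ∀ e, X.jetIncl E n (p.2 e) = X.prolongOne (p.1 e)}
  | 0 => ⟨(AddMonoidHom.id E, X.prolongOne), fun _ => rfl⟩
  | n + 1 =>
    let p := prolongPair n
    ⟨(p.1.2, AddMonoidHom.mk'
      (fun e => (⟨X.prolongOne (p.1.2 e), X.prolongOne_mem (X.jetStage E n) _ _ (p.2 e)⟩ :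
        (X.jetStage E n).ker))
      (fun e e' => Subtype.ext
        ((congrArg (X.prolongOne (E := X.Jet E (n + 1))) (map_add p.1.2 e e')).trans
          (map_add (X.prolongOne (E := X.Jet E (n + 1))) (p.1.2 e) (p.1.2 e'))))), fun _ => rfl⟩

/-- The `n`-jet prolongation `jⁿ : E → Jⁿ E`. -/
def prolong (n : ℕ) : E →+ X.Jet E n := (X.prolongPair E n).1.1

theorem prolong_zero (e : E) : X.prolong E 0 e = e := rfl

theorem jetIncl_prolong (n : ℕ) (e : E) :
    X.jetIncl E n (X.prolong E (n + 1) e) = X.prolongOne (X.prolong E n e) :=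
  (X.prolongPair E n).2 e

/-- The Spencer operator `Ωᵐ Jⁿ⁺¹ E → Ωᵐ⁺¹ Jⁿ E`,
`ω ⊗ ∑ [yⱼ ⊗ zⱼ] ⊗ ξⱼ ↦ ∑ d(ω yⱼ) zⱼ ⊗ ξⱼ`. -/
def spencer (n m : ℕ) :
    BT A (X.Form m) (X.Jet E (n + 1)) →+ BT A (X.Form (m + 1)) (X.Jet E n) :=
  (X.spencerOne (X.Jet E n) m).comp (BT.map (X.Form m) (X.jetIncl E n))

/-- The map `E → Jⁿ E ≅ Ω⁰ ⊗_A Jⁿ E` that starts the Spencer complex. -/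
def augment (n : ℕ) : E →+ BT A (X.Form 0) (X.Jet E n) :=
  AddMonoidHom.mk' (fun e => BT.tmul A X.oneForm (X.prolong E n e))
    (fun e e' => by rw [map_add, BT.tmul_add])

theorem spencer_augment (n : ℕ) (e : E) : X.spencer E n 0 (X.augment E (n + 1) e) = 0 := by
  change X.spencerOne _ 0 (BT.tmul A X.oneForm (X.jetIncl E n (X.prolong E (n + 1) e))) = 0
  rw [jetIncl_prolong]
  change BT.tmul A (X.spencerForm X.oneForm (X.jmk (1 ⊗ₜ 1))) _ = 0
  have h : X.spencerForm X.oneForm (X.jmk (1 ⊗ₜ 1)) = 0 :=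
    val_injective ((X.dab_jmk 1 1).trans (by simp [d_one]))
  rw [h, BT.zero_tmul]

theorem map_spencerOne {F G : Type u} [AddCommGroup F] [Module A F] [AddCommGroup G] [Module A G]
    (f : F →ₗ[A] G) (g : BT A X.J1 F →ₗ[A] BT A X.J1 G) (hg : ∀ y, g y = BT.map X.J1 f y) (m : ℕ)
    (x : BT A (X.Form m) (BT A X.J1 F)) :
    BT.map (X.Form (m + 1)) f (X.spencerOne F m x) =
      X.spencerOne G m (BT.map (X.Form m) g x) := by
  induction x using BT.induction with
  | h0 => simp
  | ha x y hx hy => simp only [map_add, hx, hy]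
  | ht ω y =>
    rw [BT.map_tmul, hg]
    induction y using BT.induction with
    | h0 => simp [BT.tmul_zero]
    | ha x y hx hy => simp only [BT.tmul_add, map_add, hx, hy]
    | ht p f => rfl

theorem spencer_spencer (n m : ℕ) (x : BT A (X.Form m) (X.Jet E (n + 2))) :
    X.spencer E n (m + 1) (X.spencer E (n + 1) m x) = 0 := by
  let g : BT A X.J1 (X.Jet E (n + 1)) →ₗ[A] BT A X.J1 (BT A X.J1 (X.Jet E n)) :=
    { toFun := BT.map X.J1 (X.jetIncl E n)
      map_add' := map_add _
      map_smul' := BT.map_smul A _ }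
  change X.spencerOne _ (m + 1) (BT.map _ (X.jetIncl E n) (X.spencerOne _ m _)) = 0
  rw [X.map_spencerOne (X.jetIncl E n) g (fun _ => rfl)]
  induction x using BT.induction with
  | h0 => simp
  | ha x y hx hy => simp only [map_add, hx, hy, add_zero]
  | ht ω ξ =>
    rw [BT.map_tmul, BT.map_tmul, spencerOne_spencerOne]
    change _ • X.wedge _ _ 1 (BT.tmul A _ (X.DI _ (BT.map X.J1 (X.jetIncl E n) _))) -
      X.wedge _ _ 2 (BT.tmul A _ (X.DII _ (BT.map X.J1 (X.jetIncl E n) _))) = 0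
    rw [jetIncl_DI, jetIncl_DII, BT.tmul_zero, BT.tmul_zero]
    simp

/-- The cocycles in `Ωᵐ Jⁿ E` of the Spencer complex
`0 → E → J^(n+m) E → Ω¹ J^(n+m-1) E → ⋯ → Ω^(n+m) ⊗_A E → 0`. -/
def spencerKer : (n m : ℕ) → AddSubgroup (BT A (X.Form m) (X.Jet E n))
  | 0, _ => ⊤
  | n + 1, m => (X.spencer E n m).ker

/-- The coboundaries of the Spencer complex in `Ωᵐ Jⁿ E`. -/
def spencerIm : (n m : ℕ) → AddSubgroup (BT A (X.Form m) (X.Jet E n))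
  | n, 0 => (X.augment E n).range
  | n, m + 1 => (X.spencer E n m).range

theorem spencerIm_le_spencerKer : ∀ n m, X.spencerIm E n m ≤ X.spencerKer E n m
  | 0, _ => le_top
  | n + 1, 0 => by
    rintro _ ⟨e, rfl⟩
    exact X.spencer_augment E n e
  | n + 1, m + 1 => by
    rintro _ ⟨x, rfl⟩
    exact X.spencer_spencer E n m x

/-- The Spencer cohomology `H_S^{n,m}(E)` at `Ωᵐ Jⁿ E`. -/
abbrev SpencerCohomology (n m : ℕ) : Type u :=
  X.spencerKer E n m ⧸ (X.spencerIm E n m).addSubgroupOf (X.spencerKer E n m)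

end Jet

end ExtAlg

end NCJet

/-
The product and `[a ⊗ b] ↦ (da) b` identify `J¹ A` with `A × Ω¹`, whence `J¹ F ≅ F ⊕ Ω¹ F` as
abelian groups. In these coordinates `ξ ∈ J¹ Jⁿ⁺¹` is holonomic iff its `Ω¹`-component is a
Spencer cocycle which projects to the `Ω¹`-component of its value in `Jⁿ⁺¹`. By flatness
`0 → Sⁿ → Jⁿ → Jⁿ⁻¹` is then exact; the obstruction to lifting along `Jⁿ⁺² → Jⁿ⁺¹` is a class in
`H_δ^{n,2}`, so acyclicity makes the projections surjective. Hence the Spencer complex of order `N`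
is an extension of the one of order `N - 1` by a `δ`-complex, up to the augmentation, and one
concludes by induction on the order of the jets.
-/

namespace NCJet

section Subquotients

theorem subsingleton_subquotient_iff {G : Type*} [AddGroup G] {Z B : AddSubgroup G} :
    Subsingleton (Z ⧸ B.addSubgroupOf Z) ↔ Z ≤ B := by
  rw [QuotientAddGroup.subsingleton_iff, AddSubgroup.addSubgroupOf_eq_top]

variable {A B C : Type*} [AddGroup A] [AddGroup B] [AddGroup C]

/-- `Z` and `B` stand for the cocycles and the coboundaries, in one degree, of the terms of a short
exact sequence of complexes. -/
theorem cocycles_le_coboundaries_of_exact {i : A →+ B} {p : B →+ C} (hip : Function.Exact i p)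
    {ZA BA : AddSubgroup A} {ZB BB : AddSubgroup B} {ZC BC : AddSubgroup C} (hB : BB ≤ ZB)
    (hZi : ZB.comap i ≤ ZA) (hBi : BA ≤ BB.comap i) (hZp : ZB ≤ ZC.comap p) (hBp : BC ≤ BB.map p)
    (hA : ZA ≤ BA) (hC : ZC ≤ BC) : ZB ≤ BB := by
  intro x hx
  obtain ⟨b, hb, hpb⟩ := hBp (hC (hZp hx))
  obtain ⟨a, ha⟩ := (hip (x - b)).1 (by rw [map_sub, hpb, sub_self])
  have hxb : x - b ∈ BB := ha ▸ hBi (hA (hZi (show i a ∈ ZB from ha ▸ sub_mem hx (hB hb))))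
  simpa using add_mem hxb hb

end Subquotients

section BalancedTensor

variable {A : Type u} [Ring A] {M N : Type u} [AddCommGroup M] [Module Aᵐᵒᵖ M]
  [AddCommGroup N] [Module Aᵐᵒᵖ N]
variable {E F G : Type u} [AddCommGroup E] [Module A E] [AddCommGroup F] [Module A F]
  [AddCommGroup G] [Module A G]

theorem BT.hom_ext {H : Type*} [AddMonoid H] {f g : BT A M E →+ H}
    (h : ∀ m e, f (BT.tmul A m e) = g (BT.tmul A m e)) : f = g := by
  ext x
  induction x using BT.induction with
  | h0 => rw [_root_.map_zero, _root_.map_zero]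
  | ht m e => exact h m e
  | ha x y hx hy => rw [map_add, map_add, hx, hy]

theorem BT.hom_ext₂ [Module A N] [SMulCommClass A Aᵐᵒᵖ N] {H : Type*} [AddCommMonoid H]
    {f g : BT A M (BT A N E) →+ H}
    (h : ∀ m n e, f (BT.tmul A m (BT.tmul A n e)) = g (BT.tmul A m (BT.tmul A n e))) : f = g :=
  BT.hom_ext fun m y => DFunLike.congr_fun
    (BT.hom_ext (f := f.comp (AddMonoidHom.mk' (BT.tmul A m) (BT.tmul_add A m)))
      (g := g.comp (AddMonoidHom.mk' (BT.tmul A m) (BT.tmul_add A m))) (h m)) y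

theorem BT.sub_tmul (m n : M) (e : E) :
    BT.tmul A (m - n) e = BT.tmul A m e - BT.tmul A n e :=
  map_sub (AddMonoidHom.mk' (BT.tmul A · e) (BT.add_tmul A · · e)) m n

theorem BT.neg_tmul (m : M) (e : E) : BT.tmul A (-m) e = -BT.tmul A m e :=
  map_neg (AddMonoidHom.mk' (BT.tmul A · e) (BT.add_tmul A · · e)) m

theorem BT.zsmul_tmul (z : ℤ) (m : M) (e : E) : BT.tmul A (z • m) e = z • BT.tmul A m e :=
  map_zsmul (AddMonoidHom.mk' (BT.tmul A · e) (BT.add_tmul A · · e)) z m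

theorem BT.map_id : BT.map M (LinearMap.id : E →ₗ[A] E) = AddMonoidHom.id _ :=
  BT.hom_ext fun _ _ => rfl

theorem BT.map_map (g : F →ₗ[A] G) (f : E →ₗ[A] F) (x : BT A M E) :
    BT.map M g (BT.map M f x) = BT.map M (g ∘ₗ f) x :=
  DFunLike.congr_fun (BT.hom_ext (f := (BT.map M g).comp (BT.map M f)) (g := BT.map M (g ∘ₗ f))
    fun _ _ => rfl) x

theorem BT.map_zero : BT.map M (0 : E →ₗ[A] F) = 0 :=
  BT.hom_ext fun m _ => BT.tmul_zero A m

/-- The quotient map from the tensor product of abelian groups onto the one over `A`. -/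
def BT.mk : M ⊗[ℤ] E →+ BT A M E := QuotientAddGroup.mk' (balancedRel A M E)

theorem BT.mk_surjective : Function.Surjective (BT.mk (A := A) (M := M) (E := E)) :=
  QuotientAddGroup.mk'_surjective _

theorem BT.mk_eq_zero_iff {t : M ⊗[ℤ] E} : BT.mk (A := A) t = 0 ↔ t ∈ balancedRel A M E :=
  QuotientAddGroup.eq_zero_iff t

theorem BT.map_mk (f : E →ₗ[A] F) (t : M ⊗[ℤ] E) :
    BT.map M f (BT.mk t) = BT.mk (f.toAddMonoidHom.toIntLinearMap.lTensor M t) := by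
  induction t using TensorProduct.induction_on with
  | zero => simp only [_root_.map_zero]
  | tmul m e => rfl
  | add s t hs ht => simp only [map_add, hs, ht]

theorem BT.map_surjective {f : E →ₗ[A] F} (hf : Function.Surjective f) :
    Function.Surjective (BT.map M f) := by
  intro y
  obtain ⟨t, rfl⟩ := BT.mk_surjective y
  obtain ⟨s, rfl⟩ := LinearMap.lTensor_surjective M (g := f.toAddMonoidHom.toIntLinearMap) hf t
  exact ⟨BT.mk s, BT.map_mk f s⟩

theorem balancedRel_le_map_lTensor {g : F →ₗ[A] G} (hg : Function.Surjective g) :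
    balancedRel A M G ≤ (balancedRel A M F).map
      (g.toAddMonoidHom.toIntLinearMap.lTensor M).toAddMonoidHom := by
  refine (AddSubgroup.closure_le _).2 ?_
  rintro _ ⟨m, a, e, rfl⟩
  obtain ⟨e, rfl⟩ := hg e
  exact ⟨_, AddSubgroup.subset_closure ⟨m, a, e, rfl⟩, by simp⟩

theorem BT.map_exact {f : E →ₗ[A] F} {g : F →ₗ[A] G} (hfg : Function.Exact f g)
    (hg : Function.Surjective g) : Function.Exact (BT.map M f) (BT.map M g) := by
  refine fun x => ⟨fun hx => ?_, ?_⟩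
  · obtain ⟨t, rfl⟩ := BT.mk_surjective x
    rw [BT.map_mk, BT.mk_eq_zero_iff] at hx
    obtain ⟨r, hr, hrt⟩ := balancedRel_le_map_lTensor hg hx
    have hexact := lTensor_exact M (f := f.toAddMonoidHom.toIntLinearMap)
      (g := g.toAddMonoidHom.toIntLinearMap) hfg hg
    obtain ⟨s, hs⟩ := (hexact (t - r)).1 ((map_sub _ t r).trans (sub_eq_zero.2 hrt.symm))
    exact ⟨BT.mk s, by rw [BT.map_mk, hs, map_sub, BT.mk_eq_zero_iff.2 hr, sub_zero]⟩
  · rintro ⟨y, rfl⟩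
    rw [BT.map_map, hfg.linearMap_comp_eq_zero, BT.map_zero, AddMonoidHom.zero_apply]

theorem IsFlatRight.map_exact (hM : IsFlatRight A M) {f : E →ₗ[A] F} {g : F →ₗ[A] G}
    (hfg : Function.Exact f g) : Function.Exact (BT.map M f) (BT.map M g) := by
  have hrange : Function.Exact f g.rangeRestrict := fun y =>
    (Subtype.ext_iff (a1 := g.rangeRestrict y) (a2 := 0)).trans (hfg y)
  intro x
  rw [← BT.map_exact hrange g.surjective_rangeRestrict x,
    ← (injective_iff_map_eq_zero' _).1 (hM _ _ (LinearMap.range g).subtype Subtype.val_injective),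
    BT.map_map]
  rfl

/-- The map `g ⊗_A id_E` induced by a map `g` of right modules. -/
def BT.rTensor (E : Type u) [AddCommGroup E] [Module A E] (g : M →ₗ[Aᵐᵒᵖ] N) :
    BT A M E →+ BT A N E :=
  BT.lift (fun m e => BT.tmul A (g m) e) (fun m n e => by rw [map_add, BT.add_tmul])
    (fun m => BT.tmul_add A (g m)) (fun m a e => by rw [g.map_smul, BT.smul_tmul])

theorem BT.rTensor_map (g : M →ₗ[Aᵐᵒᵖ] N) (f : E →ₗ[A] F) (x : BT A M E) :
    BT.rTensor F g (BT.map M f x) = BT.map N f (BT.rTensor E g x) :=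
  DFunLike.congr_fun (BT.hom_ext (f := (BT.rTensor F g).comp (BT.map M f))
    (g := (BT.map N f).comp (BT.rTensor E g)) fun _ _ => rfl) x

section Bimodule

variable [Module A M] [SMulCommClass A Aᵐᵒᵖ M] [Module A N] [SMulCommClass A Aᵐᵒᵖ N]

variable (M) in
/-- `BT.map M f` as a map of left modules, for a bimodule `M`. -/
def BT.mapₗ (f : E →ₗ[A] F) : BT A M E →ₗ[A] BT A M F where
  toFun := BT.map M f
  map_add' := map_add _
  map_smul' := BT.map_smul A f

theorem BT.rTensor_smul {g : M →ₗ[Aᵐᵒᵖ] N} (hg : ∀ (a : A) m, g (a • m) = a • g m) (a : A)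
    (x : BT A M E) : BT.rTensor E g (a • x) = a • BT.rTensor E g x :=
  DFunLike.congr_fun (BT.hom_ext (f := (BT.rTensor E g).comp (BT.smulHom A a))
    (g := (BT.smulHom A a).comp (BT.rTensor E g)) fun m e =>
      congrArg (BT.tmul A · e) (hg a m)) x

end Bimodule

end BalancedTensor

namespace ExtAlg

variable {k : Type v} {A : Type u} [CommRing k] [Ring A] [Algebra k A] (X : ExtAlg k A)

section OneForms

theorem mul_adb_mem_range (a : A) {w : X.Ω} (hw : w ∈ LinearMap.range X.adb) :
    X.ofA a * w ∈ LinearMap.range X.adb := by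
  obtain ⟨x, rfl⟩ := hw
  exact ⟨a • x, X.adb_smul a x⟩

theorem adb_mul_mem_range (a : A) {w : X.Ω} (hw : w ∈ LinearMap.range X.adb) :
    w * X.ofA a ∈ LinearMap.range X.adb := by
  obtain ⟨x, rfl⟩ := hw
  exact ⟨rmul a x - LinearMap.mul' k A x ⊗ₜ a, by
    rw [map_sub, adb_rmul, adb_tmul, add_sub_cancel_right]⟩

theorem decompose_one_mem_range_adb [DirectSum.Decomposition X.deg] (x : X.Ω) :
    (DirectSum.decompose X.deg x 1 : X.Ω) ∈ LinearMap.range X.adb := by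
  let : GradedAlgebra X.deg := { X.gradedMonoid with }
  induction X.generated.ge (Algebra.mem_top (x := x)) using Algebra.adjoin_induction with
  | mem x hx =>
    rcases hx with ⟨a, rfl⟩ | ⟨a, rfl⟩
    · rw [DirectSum.decompose_of_mem_ne X.deg (X.ofA_mem a) zero_ne_one]
      exact zero_mem _
    · rw [DirectSum.decompose_of_mem_same X.deg (X.d_mem 0 _ (X.ofA_mem a))]
      exact ⟨1 ⊗ₜ a, by rw [adb_tmul, map_one, one_mul]⟩
  | algebraMap r =>
    rw [← X.ofA.commutes, DirectSum.decompose_of_mem_ne X.deg (X.ofA_mem _) zero_ne_one]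
    exact zero_mem _
  | add x y _ _ hx hy =>
    rw [DirectSum.decompose_add]
    exact add_mem hx hy
  | mul x y _ _ hx hy =>
    obtain ⟨a, ha⟩ : ∃ a, X.ofA a = DirectSum.decompose X.deg x 0 :=
      X.range_ofA.ge (DirectSum.decompose X.deg x 0).2
    obtain ⟨b, hb⟩ : ∃ b, X.ofA b = DirectSum.decompose X.deg y 0 :=
      X.range_ofA.ge (DirectSum.decompose X.deg y 0).2
    rw [DirectSum.decompose_mul, DirectSum.coe_mul_apply_eq_sum_antidiagonal,
      Finset.Nat.sum_antidiagonal_succ, Finset.Nat.antidiagonal_zero, Finset.sum_singleton]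
    dsimp only
    rw [← ha, zero_add, ← hb]
    exact add_mem (X.mul_adb_mem_range a hy) (X.adb_mul_mem_range b hx)

theorem range_adb : LinearMap.range X.adb = X.deg 1 := by
  classical
  let := X.isInternal.chooseDecomposition
  refine le_antisymm ?_ fun x hx => ?_
  · rintro _ ⟨x, rfl⟩
    refine X.mem_of_tmul X.adb (fun a b => ?_) x
    rw [adb_tmul]
    exact X.ofA_mul_mem a (X.d_mem 0 _ (X.ofA_mem b))
  · rw [← DirectSum.decompose_of_mem_same X.deg hx]
    exact X.decompose_one_mem_range_adb x

end OneForms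

section JetSplitting

theorem jmk_surjective : Function.Surjective X.jmk := X.jetRel.mkQ_surjective

theorem dab_jmk_eq (x : A ⊗[k] A) :
    X.dab (X.jmk x) = X.d (X.ofA (LinearMap.mul' k A x)) - X.adb x := by
  have h := X.preSpencer_eq (m := 0) (val_mem X.oneForm) x
  rw [pow_zero, one_mul, show X.val 0 X.oneForm = 1 from rfl, d_one, zero_mul, zero_add,
    one_mul] at h
  exact h

theorem jproj_smul (a : A) (p : X.J1) : X.jproj (a • p) = a * X.jproj p := by
  obtain ⟨x, rfl⟩ := X.jmk_surjective p
  exact mul'_smul a x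

theorem jproj_op_smul (a : A) (p : X.J1) : X.jproj (op a • p) = X.jproj p * a := by
  obtain ⟨x, rfl⟩ := X.jmk_surjective p
  exact mul'_rmul a x

/-- The product `J¹ A → A`, `[a ⊗ b] ↦ a b`, as a map of right modules. -/
def jprojRight : X.J1 →ₗ[Aᵐᵒᵖ] A where
  toFun := X.jproj
  map_add' := map_add _
  map_smul' c := X.jproj_op_smul c.unop

/-- The map `J¹ A → Ω¹`, `[a ⊗ b] ↦ (da) b`, as a map of right modules into `X.Form 1`
(`X.dab` takes values in the total algebra). -/
def dabForm : X.J1 →ₗ[Aᵐᵒᵖ] X.Form 1 where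
  toFun := X.spencerForm X.oneForm
  map_add' := map_add _
  map_smul' c p := val_injective (X.dab_op_smul c.unop p)

theorem val_dabForm (p : X.J1) : X.val 1 (X.dabForm p) = X.dab p := rfl

theorem dabForm_smul (a : A) (p : X.J1) :
    X.dabForm (a • p) = a • X.dabForm p + op (X.jproj p) • X.dA a :=
  val_injective (by
    rw [map_add, val_dabForm, val_smul, val_op_smul, val_dA, val_dabForm, dab_smul, unop_op])

theorem jprojRight_prod_dabForm_bijective :
    Function.Bijective (X.jprojRight.prod X.dabForm) := by
  refine ⟨(injective_iff_map_eq_zero _).2 fun p hp => ?_, ?_⟩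
  · obtain ⟨x, rfl⟩ := X.jmk_surjective p
    obtain ⟨hmul, hdab⟩ := Prod.mk.inj hp
    replace hmul : LinearMap.mul' k A x = 0 := hmul
    replace hdab : X.dab (X.jmk x) = 0 := congrArg (X.val 1) hdab
    rw [dab_jmk_eq, hmul, map_zero, map_zero, zero_sub, neg_eq_zero] at hdab
    exact (Submodule.Quotient.mk_eq_zero _).2 ⟨hmul, hdab⟩
  · rintro ⟨a, ω⟩
    obtain ⟨x, hx⟩ := X.range_adb.ge (val_mem (X.dA a - ω))
    let y := x + (a - LinearMap.mul' k A x) ⊗ₜ 1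
    have hmul : LinearMap.mul' k A y = a := by
      rw [map_add, LinearMap.mul'_apply, mul_one, add_sub_cancel]
    have hadb : X.adb y = X.d (X.ofA a) - X.val 1 ω := by
      rw [map_add, hx, adb_tmul, map_one, d_one, mul_zero, add_zero, map_sub, val_dA]
    refine ⟨X.jmk y, Prod.ext hmul (val_injective ?_)⟩
    exact (X.dab_jmk_eq y).trans (by rw [hmul, hadb, sub_sub_cancel])

/-- The decomposition `J¹ A ≅ A × Ω¹`, which respects the right actions only. -/
def jetSplitting : X.J1 ≃ₗ[Aᵐᵒᵖ] A × X.Form 1 :=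
  LinearEquiv.ofBijective (X.jprojRight.prod X.dabForm) X.jprojRight_prod_dabForm_bijective

variable {X} in
theorem J1.ext {p q : X.J1} (hproj : X.jproj p = X.jproj q) (hdab : X.dabForm p = X.dabForm q) :
    p = q :=
  X.jetSplitting.injective (Prod.ext hproj hdab)

/-- The inclusion `Ω¹ → J¹ A` of one-forms as the kernel of the product `J¹ A → A`. -/
def formJ1 : X.Form 1 →ₗ[Aᵐᵒᵖ] X.J1 :=
  X.jetSplitting.symm ∘ₗ LinearMap.inr Aᵐᵒᵖ A (X.Form 1)

@[simp] theorem jproj_formJ1 (ω : X.Form 1) : X.jproj (X.formJ1 ω) = 0 :=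
  congrArg Prod.fst (X.jetSplitting.apply_symm_apply (0, ω))

@[simp] theorem dabForm_formJ1 (ω : X.Form 1) : X.dabForm (X.formJ1 ω) = ω :=
  congrArg Prod.snd (X.jetSplitting.apply_symm_apply (0, ω))

theorem formJ1_smul (a : A) (ω : X.Form 1) : X.formJ1 (a • ω) = a • X.formJ1 ω :=
  J1.ext (by rw [jproj_smul, jproj_formJ1, jproj_formJ1, mul_zero])
    (by rw [dabForm_smul, dabForm_formJ1, dabForm_formJ1, jproj_formJ1, op_zero, zero_smul,
      add_zero])

@[simp] theorem dabForm_jmk_one : X.dabForm (X.jmk (1 ⊗ₜ 1)) = 0 :=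
  val_injective ((X.dab_jmk 1 1).trans (by rw [map_one, d_one, zero_mul, map_zero]))

end JetSplitting

section OneJets

variable (F : Type u) [AddCommGroup F] [Module A F]

/-- The projection `J¹ F → F`, `[a ⊗ b] ⊗ f ↦ a b f`. -/
def jetProj : BT A X.J1 F →ₗ[A] F where
  toFun := BT.lift (fun p f => X.jproj p • f) (fun _ _ _ => by rw [map_add, add_smul])
    (fun _ _ _ => smul_add _ _ _) (fun p a f => by rw [jproj_op_smul, mul_smul])
  map_add' := map_add _
  map_smul' a x := by
    induction x using BT.induction with
    | h0 => simp only [smul_zero, map_zero]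
    | ht p f => simp only [BT.smul_def, BT.lift_tmul, jproj_smul, mul_smul, RingHom.id_apply]
    | ha x y hx hy => simp only [smul_add, map_add, hx, hy]

@[simp] theorem jetProj_tmul (p : X.J1) (f : F) :
    X.jetProj F (BT.tmul A p f) = X.jproj p • f := rfl

/-- The map `J¹ F → Ω¹ F`, `[a ⊗ b] ⊗ f ↦ (da) b ⊗ f`, complementary to the projection to `F`. -/
def jetDiff : BT A X.J1 F →+ BT A (X.Form 1) F := BT.rTensor F X.dabForm

@[simp] theorem jetDiff_tmul (p : X.J1) (f : F) :
    X.jetDiff F (BT.tmul A p f) = BT.tmul A (X.dabForm p) f := rfl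

/-- The inclusion `Ω¹ F → J¹ F` of the kernel of the projection `J¹ F → F`. -/
def formJet : BT A (X.Form 1) F →ₗ[A] BT A X.J1 F where
  toFun := BT.rTensor F X.formJ1
  map_add' := map_add _
  map_smul' := BT.rTensor_smul X.formJ1_smul

@[simp] theorem formJet_tmul (ω : X.Form 1) (f : F) :
    X.formJet F (BT.tmul A ω f) = BT.tmul A (X.formJ1 ω) f := rfl

@[simp] theorem jetProj_formJet (θ : BT A (X.Form 1) F) : X.jetProj F (X.formJet F θ) = 0 :=
  DFunLike.congr_fun (BT.hom_ext
    (f := (X.jetProj F ∘ₗ X.formJet F).toAddMonoidHom) (g := 0) fun ω f => by simp) θ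

@[simp] theorem jetDiff_formJet (θ : BT A (X.Form 1) F) : X.jetDiff F (X.formJet F θ) = θ :=
  DFunLike.congr_fun (BT.hom_ext (f := (X.jetDiff F).comp (X.formJet F).toAddMonoidHom)
    (g := AddMonoidHom.id _) fun ω f => by simp) θ

theorem prolongOne_apply (f : F) : X.prolongOne f = BT.tmul A (X.jmk (1 ⊗ₜ 1)) f := rfl

@[simp] theorem jetProj_prolongOne (f : F) : X.jetProj F (X.prolongOne f) = f := by
  rw [prolongOne_apply, jetProj_tmul, jproj_jmk, mul_one, one_smul]

@[simp] theorem jetDiff_prolongOne (f : F) : X.jetDiff F (X.prolongOne f) = 0 := by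
  rw [prolongOne_apply, jetDiff_tmul, dabForm_jmk_one, BT.zero_tmul]

theorem prolongOne_jetProj_add_formJet_jetDiff (ξ : BT A X.J1 F) :
    X.prolongOne (X.jetProj F ξ) + X.formJet F (X.jetDiff F ξ) = ξ := by
  have hsplit (p : X.J1) :
      op (X.jproj p) • X.jmk (1 ⊗ₜ 1) + X.formJ1 (X.dabForm p) = p :=
    J1.ext (by simp [jproj_op_smul]) (by simp)
  refine DFunLike.congr_fun (BT.hom_ext
    (f := X.prolongOne.comp (X.jetProj F).toAddMonoidHom +
      (X.formJet F).toAddMonoidHom.comp (X.jetDiff F)) (g := AddMonoidHom.id _) fun p f => ?_) ξ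
  change BT.tmul A (X.jmk (1 ⊗ₜ 1)) (X.jproj p • f) + BT.tmul A (X.formJ1 (X.dabForm p)) f = _
  rw [← BT.smul_tmul, ← BT.add_tmul, hsplit]
  rfl

variable {F}

variable {X} in
theorem oneJet_ext {ξ ζ : BT A X.J1 F} (hproj : X.jetProj F ξ = X.jetProj F ζ)
    (hdiff : X.jetDiff F ξ = X.jetDiff F ζ) : ξ = ζ := by
  rw [← X.prolongOne_jetProj_add_formJet_jetDiff F ξ, hproj, hdiff,
    prolongOne_jetProj_add_formJet_jetDiff]

section Naturality

variable {G : Type u} [AddCommGroup G] [Module A G] (f : F →ₗ[A] G)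

theorem jetProj_map (x : BT A X.J1 F) : X.jetProj G (BT.map X.J1 f x) = f (X.jetProj F x) :=
  DFunLike.congr_fun (BT.hom_ext
    (f := (X.jetProj G).toAddMonoidHom.comp (BT.map X.J1 f))
    (g := (f ∘ₗ X.jetProj F).toAddMonoidHom) fun p e => by simp) x

theorem jetDiff_map (x : BT A X.J1 F) :
    X.jetDiff G (BT.map X.J1 f x) = BT.map (X.Form 1) f (X.jetDiff F x) :=
  BT.rTensor_map X.dabForm f x

theorem wedge_map (p q : ℕ) (x : BT A (X.Form p) (BT A (X.Form q) F)) :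
    X.wedge G p q (BT.map (X.Form p) (BT.mapₗ (X.Form q) f) x) =
      BT.map (X.Form (p + q)) f (X.wedge F p q x) :=
  DFunLike.congr_fun (BT.hom_ext₂
    (f := (X.wedge G p q).comp (BT.map (X.Form p) (BT.mapₗ (X.Form q) f)))
    (g := (BT.map (X.Form (p + q)) f).comp (X.wedge F p q)) fun _ _ _ => rfl) x

end Naturality

end OneJets

section Operators

theorem spencerForm_eq {m : ℕ} (ω : X.Form m) (p : X.J1) :
    X.spencerForm ω p =
      op (X.jproj p) • X.dForm ω + (-1 : ℤ) ^ m • X.mulForm ω (X.dabForm p) := by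
  obtain ⟨x, rfl⟩ := X.jmk_surjective p
  refine val_injective ((X.preSpencer_eq (val_mem ω) x).trans ?_)
  rw [← dab_jmk_eq, map_add, map_zsmul, zsmul_eq_mul, Int.cast_pow, Int.cast_neg, Int.cast_one]
  rfl

theorem formDI_eq (p q : X.J1) :
    X.formDI q p = X.dabForm (X.jproj p • q) - op (X.jproj q) • X.dabForm p := by
  obtain ⟨x, rfl⟩ := X.jmk_surjective p
  refine val_injective ((X.preDI_eq q x).trans ?_)
  rw [map_sub, val_op_smul, val_dabForm, val_dabForm, dab_smul, dab_jmk_eq, unop_op,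
    show X.jproj (X.jmk x) = LinearMap.mul' k A x from rfl]
  noncomm_ring

theorem formDII_eq (p q : X.J1) : X.formDII q p = -X.spencerForm (X.dabForm p) q := by
  have h := X.spencerForm_spencerForm X.oneForm p q
  rw [show X.val 0 X.oneForm = 1 from rfl, d_one, zero_mul, mul_zero, zero_sub, one_mul] at h
  exact val_injective ((neg_eq_iff_eq_neg.2 h).symm.trans (map_neg _ _).symm)

variable (F : Type u) [AddCommGroup F] [Module A F]

theorem DI_eq (y : BT A X.J1 (BT A X.J1 F)) :
    X.DI F y = X.jetDiff F (X.jetProj (BT A X.J1 F) y) -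
      BT.map (X.Form 1) (X.jetProj F) (X.jetDiff (BT A X.J1 F) y) :=
  DFunLike.congr_fun (BT.hom_ext₂ (f := X.DI F)
    (g := (X.jetDiff F).comp (X.jetProj _).toAddMonoidHom -
      (BT.map (X.Form 1) (X.jetProj F)).comp (X.jetDiff _)) fun p q e => by
    change BT.tmul A (X.formDI q p) e = BT.tmul A (X.dabForm (X.jproj p • q)) e -
      BT.tmul A (X.dabForm p) (X.jproj q • e)
    rw [formDI_eq, BT.sub_tmul, BT.smul_tmul]) y

theorem DII_eq (y : BT A X.J1 (BT A X.J1 F)) :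
    X.DII F y = -X.spencerOne F 1 (X.jetDiff (BT A X.J1 F) y) :=
  DFunLike.congr_fun (BT.hom_ext₂ (f := X.DII F)
    (g := -(X.spencerOne F 1).comp (X.jetDiff _)) fun p q e => by
    change BT.tmul A (X.formDII q p) e = -BT.tmul A (X.spencerForm (X.dabForm p) q) e
    rw [formDII_eq, BT.neg_tmul]) y

variable {F} in
theorem spencerOne_map_formJet (m : ℕ) (x : BT A (X.Form m) (BT A (X.Form 1) F)) :
    X.spencerOne F m (BT.map (X.Form m) (X.formJet F) x) = (-1 : ℤ) ^ m • X.wedge F m 1 x :=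
  DFunLike.congr_fun (BT.hom_ext₂
    (f := (X.spencerOne F m).comp (BT.map (X.Form m) (X.formJet F)))
    (g := (-1 : ℤ) ^ m • X.wedge F m 1) fun ω η f => by
    change BT.tmul A (X.spencerForm ω (X.formJ1 η)) f = (-1 : ℤ) ^ m • BT.tmul A (X.mulForm ω η) f
    rw [spencerForm_eq, jproj_formJ1, dabForm_formJ1, op_zero, zero_smul, zero_add,
      BT.zsmul_tmul]) x

end Operators

variable (E : Type u) [AddCommGroup E] [Module A E]

section Holonomy

theorem jetIncl_injective : ∀ n, Function.Injective (X.jetIncl E n)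
  | 0 => Function.injective_id
  | _ + 1 => Subtype.val_injective

/-- The projection `Jⁿ⁺¹ E → Jⁿ E` of holonomic jets. -/
def holProj (n : ℕ) : X.Jet E (n + 1) →ₗ[A] X.Jet E n := X.jetProj (X.Jet E n) ∘ₗ X.jetIncl E n

/-- The map `Jⁿ⁺¹ E → Ω¹ Jⁿ E`, `∑ [aⱼ ⊗ bⱼ] ⊗ ξⱼ ↦ ∑ (daⱼ) bⱼ ⊗ ξⱼ`, that is the Spencer operator
on zero-forms. -/
def holDiff (n : ℕ) : X.Jet E (n + 1) →+ BT A (X.Form 1) (X.Jet E n) :=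
  (X.jetDiff (X.Jet E n)).comp (X.jetIncl E n).toAddMonoidHom

variable {E}

theorem mem_jetStage_ker_iff {n : ℕ} (x : BT A X.J1 (X.Jet E (n + 1))) :
    x ∈ (X.jetStage E n).ker ↔
      X.holDiff E n (X.jetProj _ x) = BT.map (X.Form 1) (X.holProj E n) (X.jetDiff _ x) ∧
        X.jetDiff _ x ∈ X.spencerKer E (n + 1) 1 := by
  have hDI : X.DI (X.Jet E n) (BT.map X.J1 (X.jetIncl E n) x) =
      X.holDiff E n (X.jetProj _ x) - BT.map (X.Form 1) (X.holProj E n) (X.jetDiff _ x) := by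
    rw [DI_eq, jetProj_map, jetDiff_map, BT.map_map]
    rfl
  have hDII : X.DII (X.Jet E n) (BT.map X.J1 (X.jetIncl E n) x) =
      -X.spencer E n 1 (X.jetDiff _ x) := by
    rw [DII_eq, jetDiff_map]
    rfl
  exact and_congr ((Eq.congr_left hDI).trans sub_eq_zero) ((Eq.congr_left hDII).trans neg_eq_zero)

theorem holDiff_holProj (n : ℕ) (ξ : X.Jet E (n + 2)) :
    X.holDiff E n (X.holProj E (n + 1) ξ) =
      BT.map (X.Form 1) (X.holProj E n) (X.holDiff E (n + 1) ξ) :=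
  ((X.mem_jetStage_ker_iff _).1 (Subtype.property ξ)).1

theorem holDiff_mem_spencerKer : ∀ (n : ℕ) (ξ : X.Jet E (n + 1)),
    X.holDiff E n ξ ∈ X.spencerKer E n 1
  | 0, _ => trivial
  | _ + 1, ξ => ((X.mem_jetStage_ker_iff _).1 (Subtype.property ξ)).2

theorem map_holProj_jetIncl (n : ℕ) (ξ : X.Jet E (n + 2)) :
    BT.map X.J1 (X.holProj E n) (X.jetIncl E (n + 1) ξ) =
      X.jetIncl E n (X.holProj E (n + 1) ξ) :=
  oneJet_ext (X.jetProj_map _ _) ((X.jetDiff_map _ _).trans (X.holDiff_holProj n ξ).symm)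

theorem map_holProj_spencer (n m : ℕ) (x : BT A (X.Form m) (X.Jet E (n + 2))) :
    BT.map (X.Form (m + 1)) (X.holProj E n) (X.spencer E (n + 1) m x) =
      X.spencer E n m (BT.map (X.Form m) (X.holProj E (n + 1)) x) := by
  have hcomm : BT.mapₗ X.J1 (X.holProj E n) ∘ₗ X.jetIncl E (n + 1) =
      X.jetIncl E n ∘ₗ X.holProj E (n + 1) := LinearMap.ext (X.map_holProj_jetIncl n)
  rw [spencer, spencer, AddMonoidHom.comp_apply, AddMonoidHom.comp_apply, BT.map_map, ← hcomm,
    ← BT.map_map]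
  exact X.map_spencerOne _ _ (fun _ => rfl) m _

theorem spencerKer_le_comap_holProj : ∀ n m : ℕ,
    X.spencerKer E (n + 1) m ≤ (X.spencerKer E n m).comap (BT.map (X.Form m) (X.holProj E n))
  | 0, _ => le_top
  | n + 1, m => fun x (hx : X.spencer E (n + 1) m x = 0) => by
    rw [AddSubgroup.mem_comap, spencerKer, AddMonoidHom.mem_ker, ← map_holProj_spencer, hx,
      map_zero]

theorem holProj_prolong (n : ℕ) (e : E) :
    X.holProj E n (X.prolong E (n + 1) e) = X.prolong E n e :=
  (congrArg (X.jetProj _) (X.jetIncl_prolong E n e)).trans (X.jetProj_prolongOne _ _)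

theorem prolong_injective : ∀ n : ℕ, Function.Injective (X.prolong E n)
  | 0 => Function.injective_id
  | n + 1 => .of_comp (f := X.holProj E n) <| by
    rw [show X.holProj E n ∘ X.prolong E (n + 1) = X.prolong E n from
      funext (X.holProj_prolong n)]
    exact prolong_injective n

end Holonomy

section SymmetricForms

theorem symIncl_injective : ∀ n, Function.Injective (X.symIncl E n)
  | 0 => Function.injective_id
  | _ + 1 => Subtype.val_injective

theorem exists_symIncl_eq_of_mem_deltaKer : ∀ {n : ℕ} {x : BT A (X.Form 1) (X.Sym E n)},
    x ∈ X.deltaKer E n 1 → ∃ s, X.symIncl E n s = x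
  | 0, x, _ => ⟨x, rfl⟩
  | n + 1, x, hx => by
    have hwedge : x ∈ (X.symStage E n).ker := by
      rw [deltaKer, AddMonoidHom.mem_ker, delta, pow_one, neg_one_zsmul, AddMonoidHom.neg_apply,
        neg_eq_zero] at hx
      exact hx
    exact ⟨(⟨x, hwedge⟩ : (X.symStage E n).ker), rfl⟩

/-- Two consecutive inclusions `Sⁿ E → Jⁿ E`, `Sⁿ⁺¹ E → Jⁿ⁺¹ E`, where the second one is the
corestriction of `Sⁿ⁺¹ E → Ω¹ Sⁿ E → Ω¹ Jⁿ E → J¹ Jⁿ E`. -/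
structure SymJetStage (n : ℕ) where
  prev : X.Sym E n →ₗ[A] X.Jet E n
  cur : X.Sym E (n + 1) →ₗ[A] X.Jet E (n + 1)
  jetIncl_cur (s) :
    X.jetIncl E n (cur s) = X.formJet _ (BT.map (X.Form 1) prev (X.symIncl E n s))

namespace SymJetStage

variable {X E} {n : ℕ} (t : X.SymJetStage E n)

theorem holProj_comp_cur : X.holProj E n ∘ₗ t.cur = 0 :=
  LinearMap.ext fun s => (congrArg (X.jetProj _) (t.jetIncl_cur s)).trans (X.jetProj_formJet _ _)

theorem spencer_map_cur (m : ℕ) (x : BT A (X.Form m) (X.Sym E (n + 1))) :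
    X.spencer E n m (BT.map (X.Form m) t.cur x) =
      BT.map (X.Form (m + 1)) t.prev (X.delta E n m x) := by
  have hcomm : X.jetIncl E n ∘ₗ t.cur =
      X.formJet _ ∘ₗ BT.mapₗ (X.Form 1) t.prev ∘ₗ X.symIncl E n := LinearMap.ext t.jetIncl_cur
  rw [spencer, AddMonoidHom.comp_apply, BT.map_map, hcomm, ← BT.map_map,
    spencerOne_map_formJet, ← BT.map_map, wedge_map, delta, AddMonoidHom.smul_apply, map_zsmul,
    AddMonoidHom.comp_apply]

theorem formJet_mem_ker (s : X.Sym E (n + 2)) :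
    X.formJet _ (BT.map (X.Form 1) t.cur (X.symIncl E (n + 1) s)) ∈ (X.jetStage E n).ker := by
  refine (X.mem_jetStage_ker_iff _).2 ⟨?_, ?_⟩
  · rw [jetProj_formJet, jetDiff_formJet, map_zero, BT.map_map, holProj_comp_cur, BT.map_zero,
      AddMonoidHom.zero_apply]
  · rw [jetDiff_formJet, spencerKer, AddMonoidHom.mem_ker, spencer_map_cur, delta,
      AddMonoidHom.smul_apply, AddMonoidHom.comp_apply, symIncl_wedge, smul_zero, map_zero]

/-- The passage from `(Sⁿ E → Jⁿ E, Sⁿ⁺¹ E → Jⁿ⁺¹ E)` to `(Sⁿ⁺¹ E → Jⁿ⁺¹ E, Sⁿ⁺² E → Jⁿ⁺² E)`. -/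
def next : X.SymJetStage E (n + 1) where
  prev := t.cur
  cur := LinearMap.codRestrict (X.jetStage E n).ker
    (X.formJet _ ∘ₗ BT.mapₗ (X.Form 1) t.cur ∘ₗ X.symIncl E (n + 1)) t.formJet_mem_ker
  jetIncl_cur _ := rfl

end SymJetStage

/-- The inclusions `Sⁿ E → Jⁿ E`, starting with the identity of `E` and `Ω¹ E → J¹ E`. -/
def symJetStage : ∀ n, X.SymJetStage E n
  | 0 => ⟨LinearMap.id, X.formJet E, fun s =>
      congrArg (X.formJet E) (DFunLike.congr_fun BT.map_id s).symm⟩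
  | n + 1 => (symJetStage n).next

/-- The inclusion `Sⁿ E → Jⁿ E` of symmetric forms in holonomic jets. -/
def symJet (n : ℕ) : X.Sym E n →ₗ[A] X.Jet E n := (X.symJetStage E n).prev

variable {E}

theorem jetIncl_symJet (n : ℕ) (s : X.Sym E (n + 1)) : X.jetIncl E n (X.symJet E (n + 1) s) =
    X.formJet _ (BT.map (X.Form 1) (X.symJet E n) (X.symIncl E n s)) :=
  (X.symJetStage E n).jetIncl_cur s

theorem holProj_symJet (n : ℕ) (s : X.Sym E (n + 1)) :
    X.holProj E n (X.symJet E (n + 1) s) = 0 :=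
  DFunLike.congr_fun (X.symJetStage E n).holProj_comp_cur s

theorem holDiff_symJet (n : ℕ) (s : X.Sym E (n + 1)) :
    X.holDiff E n (X.symJet E (n + 1) s) =
      BT.map (X.Form 1) (X.symJet E n) (X.symIncl E n s) :=
  (congrArg (X.jetDiff _) (X.jetIncl_symJet n s)).trans (X.jetDiff_formJet _ _)

theorem spencer_map_symJet (n m : ℕ) (x : BT A (X.Form m) (X.Sym E (n + 1))) :
    X.spencer E n m (BT.map (X.Form m) (X.symJet E (n + 1)) x) =
      BT.map (X.Form (m + 1)) (X.symJet E n) (X.delta E n m x) :=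
  (X.symJetStage E n).spencer_map_cur m x

theorem map_symJet_zero (m : ℕ) (x : BT A (X.Form m) E) :
    BT.map (X.Form m) (X.symJet E 0) x = x :=
  DFunLike.congr_fun BT.map_id x

theorem deltaIm_le_comap_symJet : ∀ n m : ℕ,
    X.deltaIm E n m ≤ (X.spencerIm E n m).comap (BT.map (X.Form m) (X.symJet E n))
  | _, 0 => bot_le
  | n, m + 1 => by
    rintro _ ⟨x, rfl⟩
    exact ⟨BT.map (X.Form m) (X.symJet E (n + 1)) x, X.spencer_map_symJet n m x⟩

end SymmetricForms

section Flat

variable {X} {E} (hflat : X.IsFlat)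

include hflat

theorem symJet_injective : ∀ n, Function.Injective (X.symJet E n)
  | 0 => Function.injective_id
  | n + 1 => fun s t hst => X.symIncl_injective E n <| hflat 1 _ _ _ (symJet_injective n) <| by
    rw [← holDiff_symJet, hst, holDiff_symJet]

theorem comap_symJet_spencerKer_le : ∀ n m : ℕ,
    (X.spencerKer E n m).comap (BT.map (X.Form m) (X.symJet E n)) ≤ X.deltaKer E n m
  | 0, _ => le_top
  | n + 1, m => fun x (hx : X.spencer E n m (BT.map (X.Form m) (X.symJet E (n + 1)) x) = 0) => by
    rw [spencer_map_symJet] at hx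
    exact (injective_iff_map_eq_zero _).1 (hflat _ _ _ _ (symJet_injective hflat n)) _ hx

theorem exact_symJet_holProj (n : ℕ) :
    Function.Exact (X.symJet E (n + 1)) (X.holProj E n) := by
  refine fun ξ => ⟨fun hξ => ?_, fun ⟨s, hs⟩ => hs ▸ X.holProj_symJet n s⟩
  obtain ⟨x, hx⟩ : ∃ x, BT.map (X.Form 1) (X.symJet E n) x = X.holDiff E n ξ := by
    cases n with
    | zero => exact ⟨_, X.map_symJet_zero 1 _⟩
    | succ n =>
      refine ((hflat 1).map_exact (exact_symJet_holProj n) _).1 ?_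
      rw [← holDiff_holProj, hξ, map_zero]
  have hker : x ∈ X.deltaKer E n 1 := comap_symJet_spencerKer_le hflat n 1 <|
    show BT.map (X.Form 1) (X.symJet E n) x ∈ _ from hx ▸ X.holDiff_mem_spencerKer n ξ
  obtain ⟨s, rfl⟩ := X.exists_symIncl_eq_of_mem_deltaKer E hker
  refine ⟨s, X.jetIncl_injective E n (oneJet_ext ?_ ?_)⟩
  · exact (X.holProj_symJet n s).trans hξ.symm
  · exact (X.holDiff_symJet n s).trans hx

theorem exact_map_symJet_map_holProj (n m : ℕ) :
    Function.Exact (BT.map (X.Form m) (X.symJet E (n + 1))) (BT.map (X.Form m) (X.holProj E n)) :=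
  (hflat m).map_exact (exact_symJet_holProj hflat n)

end Flat

variable {X} {E}

section Lifting

variable {n : ℕ}

theorem exists_holProj_eq {η : X.Jet E (n + 1)} {θ : BT A (X.Form 1) (X.Jet E (n + 1))}
    (hθ : θ ∈ X.spencerKer E (n + 1) 1)
    (hη : BT.map (X.Form 1) (X.holProj E n) θ = X.holDiff E n η) :
    ∃ ξ, X.holProj E (n + 1) ξ = η := by
  let x := X.prolongOne η + X.formJet _ θ
  have hproj : X.jetProj _ x = η := by
    rw [map_add, jetProj_prolongOne, jetProj_formJet, add_zero]
  have hdiff : X.jetDiff _ x = θ := by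
    rw [map_add, jetDiff_prolongOne, jetDiff_formJet, zero_add]
  have hx : x ∈ (X.jetStage E n).ker :=
    (X.mem_jetStage_ker_iff x).2 (by rw [hproj, hdiff]; exact ⟨hη.symm, hθ⟩)
  exact ⟨(⟨x, hx⟩ : (X.jetStage E n).ker), hproj⟩

theorem exists_map_symJet_eq_spencer (hflat : X.IsFlat) {m : ℕ}
    {θ : BT A (X.Form m) (X.Jet E (n + 1))}
    (hθ : BT.map (X.Form m) (X.holProj E n) θ ∈ X.spencerKer E n m) :
    ∃ v, BT.map (X.Form (m + 1)) (X.symJet E n) v = X.spencer E n m θ := by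
  cases n with
  | zero => exact ⟨_, X.map_symJet_zero (m + 1) _⟩
  | succ n =>
    refine (exact_map_symJet_map_holProj hflat n (m + 1) _).1 ?_
    rw [map_holProj_spencer]
    exact hθ

theorem exists_mem_spencerKer_map_holProj_eq (hflat : X.IsFlat) {m : ℕ}
    (hδ : X.deltaKer E n (m + 1) ≤ X.deltaIm E n (m + 1))
    (hsurj : Function.Surjective (X.holProj E n)) {ζ : BT A (X.Form m) (X.Jet E n)}
    (hζ : ζ ∈ X.spencerKer E n m) :
    ∃ θ ∈ X.spencerKer E (n + 1) m, BT.map (X.Form m) (X.holProj E n) θ = ζ := by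
  obtain ⟨θ, rfl⟩ := BT.map_surjective hsurj ζ
  obtain ⟨v, hv⟩ := exists_map_symJet_eq_spencer hflat hζ
  have hcocycle : v ∈ X.deltaKer E n (m + 1) := comap_symJet_spencerKer_le hflat n (m + 1) <|
    X.spencerIm_le_spencerKer E n (m + 1) ⟨θ, hv.symm⟩
  obtain ⟨w, rfl⟩ := hδ hcocycle
  refine ⟨θ - BT.map (X.Form m) (X.symJet E (n + 1)) w, ?_, ?_⟩
  · rw [spencerKer, AddMonoidHom.mem_ker, map_sub, spencer_map_symJet, hv, sub_self]
  · rw [map_sub, (exact_map_symJet_map_holProj hflat n m).apply_apply_eq_zero, sub_zero]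

end Lifting

section Acyclic

theorem holProj_surjective (hflat : X.IsFlat)
    (hδ : ∀ n, X.deltaKer E n 2 ≤ X.deltaIm E n 2) :
    ∀ n, Function.Surjective (X.holProj E n)
  | 0 => fun e => ⟨X.prolong E 1 e, X.holProj_prolong 0 e⟩
  | n + 1 => fun η => by
    obtain ⟨θ, hθ, hη⟩ := exists_mem_spencerKer_map_holProj_eq hflat (hδ n)
      (holProj_surjective hflat hδ n) (X.holDiff_mem_spencerKer n η)
    exact exists_holProj_eq hθ hη

theorem spencerIm_le_map_holProj {n : ℕ} (hsurj : Function.Surjective (X.holProj E (n + 1))) :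
    ∀ m, X.spencerIm E n m ≤ (X.spencerIm E (n + 1) m).map (BT.map (X.Form m) (X.holProj E n))
  | 0 => by
    rintro _ ⟨e, rfl⟩
    exact ⟨_, ⟨e, rfl⟩, congrArg (BT.tmul A X.oneForm) (X.holProj_prolong n e)⟩
  | m + 1 => by
    rintro _ ⟨y, rfl⟩
    obtain ⟨y, rfl⟩ := BT.map_surjective hsurj y
    exact ⟨_, ⟨y, rfl⟩, X.map_holProj_spencer n m y⟩

theorem augment_zero_surjective : Function.Surjective (X.augment E 0) := by
  intro x
  induction x using BT.induction with
  | h0 => exact ⟨0, map_zero _⟩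
  | ha x y hx hy =>
    obtain ⟨x, rfl⟩ := hx
    obtain ⟨y, rfl⟩ := hy
    exact ⟨x + y, map_add _ _ _⟩
  | ht ω e =>
    obtain ⟨a, ha⟩ : X.val 0 ω ∈ LinearMap.range X.ofA.toLinearMap := X.range_ofA.ge (val_mem ω)
    have hω : ω = op a • X.oneForm :=
      val_injective (ha.symm.trans (one_mul (X.ofA a)).symm)
    exact ⟨(a • e : X.Jet E 0), by rw [hω, BT.smul_tmul]; rfl⟩

theorem spencerKer_zero_le_spencerIm : ∀ {m : ℕ},
    (m ≠ 0 → X.deltaKer E 0 m ≤ X.deltaIm E 0 m) → X.spencerKer E 0 m ≤ X.spencerIm E 0 m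
  | 0, _ => fun x _ => augment_zero_surjective x
  | m + 1, hδ => fun x _ => by
    obtain ⟨y, hy⟩ :=
      X.deltaIm_le_comap_symJet 0 (m + 1) (hδ m.succ_ne_zero (AddSubgroup.mem_top x))
    exact ⟨y, hy.trans (X.map_symJet_zero (m + 1) x)⟩

theorem spencerKer_le_spencerIm (hflat : X.IsFlat)
    (hδ : ∀ n m : ℕ, (n, m) ≠ (0, 0) → X.deltaKer E n m ≤ X.deltaIm E n m) (n m : ℕ) :
    X.spencerKer E n m ≤ X.spencerIm E n m := by
  have hsurj := holProj_surjective hflat fun n => hδ n 2 (by simp)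
  induction n with
  | zero => exact spencerKer_zero_le_spencerIm fun hm => hδ 0 m (by simpa using hm)
  | succ n ih =>
    exact cocycles_le_coboundaries_of_exact (exact_map_symJet_map_holProj hflat n m)
      (X.spencerIm_le_spencerKer E (n + 1) m) (comap_symJet_spencerKer_le hflat (n + 1) m)
      (X.deltaIm_le_comap_symJet (n + 1) m) (X.spencerKer_le_comap_holProj n m)
      (spencerIm_le_map_holProj (hsurj (n + 1)) m) (hδ (n + 1) m (by simp)) ih

end Acyclic

end ExtAlg

end NCJet

theorem corollary3p31_general {k : Type v} {A : Type u} [CommRing k] [Ring A] [Algebra k A]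
    (X : NCJet.ExtAlg k A) (hflat : X.IsFlat) (E : Type u) [AddCommGroup E] [Module A E]
    (hδ : ∀ n m : ℕ, (n, m) ≠ (0, 0) → Subsingleton (X.DeltaCohomology E n m)) (n m : ℕ) :
    Subsingleton (X.SpencerCohomology E n m) :=
  NCJet.subsingleton_subquotient_iff.2 <| NCJet.ExtAlg.spencerKer_le_spencerIm hflat
    (fun n m hnm => NCJet.subsingleton_subquotient_iff.1 (hδ n m hnm)) n m

theorem corollary3p31 {k : Type v} {A : Type u} [CommRing k] [Ring A] [Algebra k A]
    (X : NCJet.ExtAlg k A) (hflat : X.IsFlat)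
    (hδ : ∀ (E : Type u) [AddCommGroup E] [Module A E] (n m : ℕ), (n, m) ≠ (0, 0) →
      Subsingleton (X.DeltaCohomology E n m)) :
    ∀ (E : Type u) [AddCommGroup E] [Module A E],
      (∀ n : ℕ, Function.Injective (X.prolong E n)) ∧
        ∀ n m : ℕ, Subsingleton (X.SpencerCohomology E n m) :=
  fun E _ _ => ⟨X.prolong_injective, corollary3p31_general X hflat E (hδ E)⟩
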